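/- Let $(X,\|\cdot\|)$ be a Banach space, $a<b$ real, $\alpha>0$ with $\alpha\notin\mathbb N$, $N=\lceil\alpha\rceil$, $f\in C^N([a,b],X)$, $0<\beta<1$ and $m\in\mathbb N$, $m\ge 1$. Put $$\varphi(x)=\frac{x}{\sqrt[2m]{1+x^{2m}}},\qquad \Phi(x)=\tfrac14\left[\varphi(x+1)-\varphi(x-1)\right],$$ and, for $n\in\mathbb N$ with $\lceil na\rceil\le\lfloor nb\rfloor$, $x\in[a,b]$ and $g:[a,b]\to X$ or $g:[a,b]\to\mathbb R$, $$A_n(g,x)=A_n(g)(x)=\frac{\sum_{k=\lceil na\rceil}^{\lfloor nb\rfloor}g\left(\frac kn\right)\Phi(nx-k)}{\sum_{k=\lceil na\rceil}^{\lfloor nb\rfloor}\Phi(nx-k)}.$$ For $x\in[a,b]$ let $$D_{*x}^\alpha f(y)=\frac1{\Gamma(N-\alpha)}\int_x^y(y-t)^{N-\alpha-1}f^{(N)}(t)\,dt\quad(y\in[x,b]),$$ $$D_{x-}^\alpha f(y)=\frac{(-1)^N}{\Gamma(N-\alpha)}\int_y^x(z-y)^{N-\alpha-1}f^{(N)}(z)\,dz\quad(y\in[a,x])$$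 be the left and right Caputo–Bochner fractional derivatives (Bochner integrals). On an interval $[c,d]$ write $\omega_1(g,\delta)_{[c,d]}=\sup\{\|g(u)-g(v)\|:u,v\in[c,d],\ |u-v|\le\delta\}$ and $\|g\|_{\infty,[c,d]}=\sup_{[c,d]}\|g\|$, with $\|\cdot\|_\infty=\|\cdot\|_{\infty,[a,b]}$. For $n$ with $n^{1-\beta}>2$ put $$R_n(x)=\frac{\omega_1\left(D_{x-}^\alpha f,\frac1{n^\beta}\right)_{[a,x]}+\omega_1\left(D_{*x}^\alpha f,\frac1{n^\beta}\right)_{[x,b]}}{n^{\alpha\beta}}+\frac{\|D_{x-}^\alpha f\|_{\infty,[a,x]}(x-a)^\alpha+\|D_{*x}^\alpha f\|_{\infty,[x,b]}(b-x)^\alpha}{4m(n^{1-\beta}-2)^{2m}}.$$ Then $D_{x-}^\alpha f$ on $[a,x]$ and $D_{*x}^\alpha f$ on $[x,b]$ are bounded uniformly in $x\in[a,b]$ (so that all suprema here and below are finite), and for every $n\in\mathbb N$ with $n^{1-\beta}>2$ and $\lceil na\rceil\le\lfloor nb\rfloor$, where sums $\sum_{j=1}^{N-1}$ are $0$ for $N=1$: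 (i) for all $x\in[a,b]$, $$\left\|A_n(f,x)-\sum_{j=1}^{N-1}\frac{f^{(j)}(x)}{j!}A_n\left((\cdot-x)^j\right)(x)-f(x)\right\|\le\frac{2\sqrt[2m]{1+4^m}}{\Gamma(\alpha+1)}R_n(x);$$ (ii) if $x\in[a,b]$ and $f^{(j)}(x)=0$ for $j=1,\dots,N-1$, then $$\|A_n(f,x)-f(x)\|\le\frac{2\sqrt[2m]{1+4^m}}{\Gamma(\alpha+1)}R_n(x);$$ (iii) for all $x\in[a,b]$, $$\|A_n(f,x)-f(x)\|\le2\sqrt[2m]{1+4^m}\left\{\sum_{j=1}^{N-1}\frac{\|f^{(j)}(x)\|}{j!}\left\{\frac1{n^{\beta j}}+\frac{(b-a)^j}{4m(n^{1-\beta}-2)^{2m}}\right\}+\frac{R_n(x)}{\Gamma(\alpha+1)}\right\};$$ (iv) $A_nf-f$ is bounded on $[a,b]$ and $$\|A_nf-f\|_\infty\le2\sqrt[2m]{1+4^m}\Bigg\{\sum_{j=1}^{N-1}\frac{\|f^{(j)}\|_\infty}{j!}\left\{\frac1{n^{\beta j}}+\frac{(b-a)^j}{4m(n^{1-\beta}-2)^{2m}}\right\}$$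 $$+\frac1{\Gamma(\alpha+1)}\Bigg\{\frac{\sup_{x\in[a,b]}\omega_1\left(D_{x-}^\alpha f,\frac1{n^\beta}\right)_{[a,x]}+\sup_{x\in[a,b]}\omega_1\left(D_{*x}^\alpha f,\frac1{n^\beta}\right)_{[x,b]}}{n^{\alpha\beta}}$$ $$+\frac{(b-a)^\alpha}{4m(n^{1-\beta}-2)^{2m}}\left(\sup_{x\in[a,b]}\|D_{x-}^\alpha f\|_{\infty,[a,x]}+\sup_{x\in[a,b]}\|D_{*x}^\alpha f\|_{\infty,[x,b]}\right)\Bigg\}\Bigg\}.$$ Moreover, as $n\to\infty$, the right-hand side of (iii) tends to $0$ for every $x\in[a,b]$ and the right-hand side of (iv) tends to $0$; hence $A_n(f,x)\to f(x)$ for every $x\in[a,b]$, and $A_nf\to f$ uniformly on $[a,b]$. -/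

import Mathlib

open Filter Topology
open scoped Nat

noncomputable section

/-- The algebraic sigmoidal function `φ(x) = x / (1 + x^{2m})^{1/(2m)}`. -/
def algSigmoid (m : ℕ) (x : ℝ) : ℝ :=
  x / (1 + x ^ (2 * m)) ^ (1 / (2 * (m : ℝ)))

/-- The bell-shaped density `Φ(x) = (φ(x + 1) - φ(x - 1)) / 4`. -/
def algDensity (m : ℕ) (x : ℝ) : ℝ :=
  (1 / 4) * (algSigmoid m (x + 1) - algSigmoid m (x - 1))

/-- The neural network operator
`A_n(f, x) = (∑_{k=⌈na⌉}^{⌊nb⌋} Φ(nx - k) f(k/n)) / (∑_{k=⌈na⌉}^{⌊nb⌋} Φ(nx - k))`,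
for functions with values in a real vector space; it is meaningful when `⌈na⌉ ≤ ⌊nb⌋`. -/
def neuralOp {V : Type*} [AddCommGroup V] [Module ℝ V]
    (m : ℕ) (a b : ℝ) (n : ℕ) (f : ℝ → V) (x : ℝ) : V :=
  (∑ k ∈ Finset.Icc ⌈(n : ℝ) * a⌉ ⌊(n : ℝ) * b⌋, algDensity m ((n : ℝ) * x - (k : ℝ)))⁻¹ •
    ∑ k ∈ Finset.Icc ⌈(n : ℝ) * a⌉ ⌊(n : ℝ) * b⌋,
      algDensity m ((n : ℝ) * x - (k : ℝ)) • f ((k : ℝ) / (n : ℝ))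

/-- The first modulus of continuity `ω₁(g, δ)` of `g` on the interval `[c, d]`. -/
def modCont {V : Type*} [NormedAddCommGroup V] (g : ℝ → V) (δ c d : ℝ) : ℝ :=
  sSup {r : ℝ | ∃ u ∈ Set.Icc c d, ∃ v ∈ Set.Icc c d, |u - v| ≤ δ ∧ r = ‖g u - g v‖}

/-- The sup norm of `g` on the interval `[c, d]`. -/
def supNormOn {V : Type*} [NormedAddCommGroup V] (g : ℝ → V) (c d : ℝ) : ℝ :=
  sSup ((fun y => ‖g y‖) '' Set.Icc c d)

section Caputo

variable {X : Type*} [NormedAddCommGroup X] [NormedSpace ℝ X]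

/-- The left Caputo–Bochner derivative `D_{*x}^α f (y)` of non-integer order `α > 0`, `N = ⌈α⌉`, of
a function `f` on `[a, b]`, based at `x ∈ [a, b]`; by convention it vanishes for `y < x`. -/
def caputoLeft (a b α : ℝ) (f : ℝ → X) (x y : ℝ) : X :=
  if x ≤ y then
    (1 / Real.Gamma ((⌈α⌉₊ : ℝ) - α)) •
      ∫ t in x..y, (y - t) ^ ((⌈α⌉₊ : ℝ) - α - 1) • iteratedDerivWithin ⌈α⌉₊ f (Set.Icc a b) t
  else 0

/-- The right Caputo–Bochner derivative `D_{x-}^α f (y)` of non-integer order `α > 0`, `N = ⌈α⌉`, of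
a function `f` on `[a, b]`, based at `x ∈ [a, b]`; by convention it vanishes for `y > x`. -/
def caputoRight (a b α : ℝ) (f : ℝ → X) (x y : ℝ) : X :=
  if y ≤ x then
    ((-1) ^ ⌈α⌉₊ / Real.Gamma ((⌈α⌉₊ : ℝ) - α)) •
      ∫ z in y..x, (z - y) ^ ((⌈α⌉₊ : ℝ) - α - 1) • iteratedDerivWithin ⌈α⌉₊ f (Set.Icc a b) z
  else 0

/-- The quantity
`(ω₁(D_{x-}^α f, n^{-β})_{[a,x]} + ω₁(D_{*x}^α f, n^{-β})_{[x,b]}) / n^{αβ}`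
`+ (‖D_{x-}^α f‖_{∞,[a,x]} (x-a)^α + ‖D_{*x}^α f‖_{∞,[x,b]} (b-x)^α) / (4m (n^{1-β}-2)^{2m})`. -/
def fracTerm (a b α β : ℝ) (m : ℕ) (f : ℝ → X) (n : ℕ) (x : ℝ) : ℝ :=
  (modCont (caputoRight a b α f x) (1 / (n : ℝ) ^ β) a x
      + modCont (caputoLeft a b α f x) (1 / (n : ℝ) ^ β) x b) / (n : ℝ) ^ (α * β)
    + 1 / (4 * (m : ℝ) * ((n : ℝ) ^ (1 - β) - 2) ^ (2 * m))
      * (supNormOn (caputoRight a b α f x) a x * (x - a) ^ α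
        + supNormOn (caputoLeft a b α f x) x b * (b - x) ^ α)

/-- The pointwise error bound, without subtracted Taylor corrections. -/
def pointBound (a b α β : ℝ) (m : ℕ) (f : ℝ → X) (n : ℕ) (x : ℝ) : ℝ :=
  2 * (1 + 4 ^ m : ℝ) ^ (1 / (2 * (m : ℝ))) *
    ((∑ j ∈ Finset.Icc 1 (⌈α⌉₊ - 1), ‖iteratedDerivWithin j f (Set.Icc a b) x‖ / (j ! : ℝ)
        * (1 / (n : ℝ) ^ (β * (j : ℝ))
          + (b - a) ^ j / (4 * (m : ℝ) * ((n : ℝ) ^ (1 - β) - 2) ^ (2 * m))))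
      + 1 / Real.Gamma (α + 1) * fracTerm a b α β m f n x)

/-- The uniform error bound. -/
def unifBound (a b α β : ℝ) (m : ℕ) (f : ℝ → X) (n : ℕ) : ℝ :=
  2 * (1 + 4 ^ m : ℝ) ^ (1 / (2 * (m : ℝ))) *
    ((∑ j ∈ Finset.Icc 1 (⌈α⌉₊ - 1),
        supNormOn (iteratedDerivWithin j f (Set.Icc a b)) a b / (j ! : ℝ)
        * (1 / (n : ℝ) ^ (β * (j : ℝ))
          + (b - a) ^ j / (4 * (m : ℝ) * ((n : ℝ) ^ (1 - β) - 2) ^ (2 * m))))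
      + 1 / Real.Gamma (α + 1) *
        (((⨆ x : Set.Icc a b, modCont (caputoRight a b α f x) (1 / (n : ℝ) ^ β) a x)
            + (⨆ x : Set.Icc a b, modCont (caputoLeft a b α f x) (1 / (n : ℝ) ^ β) x b))
            / (n : ℝ) ^ (α * β)
          + (b - a) ^ α / (4 * (m : ℝ) * ((n : ℝ) ^ (1 - β) - 2) ^ (2 * m))
            * ((⨆ x : Set.Icc a b, supNormOn (caputoRight a b α f x) a x)
              + (⨆ x : Set.Icc a b, supNormOn (caputoLeft a b α f x) x b))))

end Caputo

end

/-! The operator is a weighted average that reproduces constants, so subtracting the degree `N - 1`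
Taylor polynomial of `f` at `x` leaves exactly the average of the Taylor remainder
(`neuralOp_sub_taylorWithinEval`). Everything then rests on two independent estimates.

The remainder: the Riemann–Liouville semigroup law, a Fubini argument with a Beta integral, rewrites
it as the order-`α` fractional integral of the Caputo derivative. A bound `K` on that derivative
between `x` and `y` therefore gives `K |y - x|^α / Γ(α + 1)`. Since the Caputo derivative vanishes
at its base point, `K` may be the modulus of continuity when `y` is within `n^{-β}` of `x`; for
other `y` it is the sup norm.

The weights: `Φ` telescopes, so its mass at distance at least `T = n^{1-β}` on either side is
governed by `1 - φ`, which Bernoulli's inequality bounds. The normalising sum is at least `Φ(1)`,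
whose reciprocal is the leading constant. `norm_neuralOp_le` combines both facts for an arbitrary
function; it is used for the Taylor remainder and again for the powers `(· - x)^j`. Convergence
needs only uniform boundedness of the Caputo derivatives. -/

/-! ### Power kernels, Beta integrals and the Riemann–Liouville semigroup law. -/

theorem integral_sub_rpow {r : ℝ} (hr : 0 < r) (x y : ℝ) :
    ∫ t in x..y, (y - t) ^ (r - 1) = (y - x) ^ r / r := by
  rw [intervalIntegral.integral_comp_sub_left (fun u => u ^ (r - 1)) y, sub_self,
    integral_rpow (Or.inl (by linarith)), sub_add_cancel, Real.zero_rpow hr.ne', sub_zero]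

theorem intervalIntegrable_sub_rpow {r : ℝ} (hr : 0 < r) (x y z : ℝ) :
    IntervalIntegrable (fun t => (z - t) ^ (r - 1)) MeasureTheory.volume x y := by
  have h := (intervalIntegral.intervalIntegrable_rpow' (a := z - x) (b := z - y)
    (r := r - 1) (by linarith)).comp_sub_left z
  simpa using h

theorem integral_rpow_mul_rpow {p q x y : ℝ} (hp : 0 < p) (hq : 0 < q) (hxy : x < y) :
    ∫ t in x..y, (y - t) ^ (p - 1) * (t - x) ^ (q - 1)
      = ProbabilityTheory.beta q p * (y - x) ^ (p + q - 1) := by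
  have ha : 0 < y - x := sub_pos.2 hxy
  have h := Complex.betaIntegral_scaled (q : ℂ) (p : ℂ) ha
  have hβ : Complex.betaIntegral q p = (ProbabilityTheory.beta q p : ℂ) := by
    rw [Complex.betaIntegral_eq_Gamma_mul_div _ _ (by simpa) (by simpa), ProbabilityTheory.beta]
    push_cast
    rw [← Complex.Gamma_ofReal, ← Complex.Gamma_ofReal, ← Complex.Gamma_ofReal]
    push_cast
    rfl
  have h1 : ∫ t in x..y, (y - t) ^ (p - 1) * (t - x) ^ (q - 1)
      = ∫ u in (0 : ℝ)..(y - x), u ^ (q - 1) * ((y - x) - u) ^ (p - 1) := by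
    have := intervalIntegral.integral_comp_sub_right (a := x) (b := y)
      (fun u => u ^ (q - 1) * ((y - x) - u) ^ (p - 1)) x
    rw [sub_self] at this
    rw [← this]
    refine intervalIntegral.integral_congr fun t _ => ?_
    simp only [sub_sub_sub_cancel_right]
    ring
  rw [h1]
  have h2 : ((∫ u in (0 : ℝ)..(y - x), u ^ (q - 1) * ((y - x) - u) ^ (p - 1) : ℝ) : ℂ)
      = ((y - x : ℝ) : ℂ) ^ ((q : ℂ) + p - 1) * Complex.betaIntegral q p := by
    rw [← h, ← intervalIntegral.integral_ofReal]
    refine intervalIntegral.integral_congr fun u hu => ?_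
    rw [Set.uIcc_of_le ha.le] at hu
    rw [Complex.ofReal_mul, Complex.ofReal_cpow hu.1, Complex.ofReal_cpow (sub_nonneg.2 hu.2)]
    push_cast
    rfl
  rw [hβ] at h2
  have h3 : ((y - x : ℝ) : ℂ) ^ ((q : ℂ) + p - 1) = (((y - x) ^ (p + q - 1) : ℝ) : ℂ) := by
    rw [Complex.ofReal_cpow ha.le]
    push_cast
    rw [add_comm (q : ℂ)]
  rw [h3, ← Complex.ofReal_mul] at h2
  rw [Complex.ofReal_injective h2, mul_comm]

/-- A non-integrable function has integral `0` by convention, whereas the Beta value just computed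
is positive. -/
theorem intervalIntegrable_rpow_mul_rpow {p q x y : ℝ} (hp : 0 < p) (hq : 0 < q) (hxy : x < y) :
    IntervalIntegrable (fun t => (y - t) ^ (p - 1) * (t - x) ^ (q - 1))
      MeasureTheory.volume x y := by
  by_contra h
  have h1 := integral_rpow_mul_rpow hp hq hxy
  rw [intervalIntegral.integral_undef h] at h1
  exact (mul_pos (ProbabilityTheory.beta_pos hq hp) (Real.rpow_pos_of_pos (sub_pos.2 hxy) _)).ne h1

section
variable {X : Type*} [NormedAddCommGroup X] [NormedSpace ℝ X]

/-- The kernel is nonnegative with explicit integral. No measurability of `D` is required, so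
regularity of the Caputo derivatives never has to be established. -/
theorem norm_integral_sub_rpow_smul_le {r x y K : ℝ} (hr : 0 < r) (hxy : x ≤ y) {D : ℝ → X}
    (hD : ∀ t ∈ Set.Icc x y, ‖D t‖ ≤ K) :
    ‖∫ t in x..y, (y - t) ^ (r - 1) • D t‖ ≤ K * ((y - x) ^ r / r) := by
  rw [← integral_sub_rpow hr x y, ← intervalIntegral.integral_const_mul]
  refine intervalIntegral.norm_integral_le_of_norm_le hxy (Eventually.of_forall fun t ht => ?_)
    ((intervalIntegrable_sub_rpow hr x y y).const_mul K)
  have h0 : 0 ≤ (y - t) ^ (r - 1) := Real.rpow_nonneg (sub_nonneg.2 ht.2) _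
  rw [norm_smul, Real.norm_of_nonneg h0, mul_comm]
  exact mul_le_mul_of_nonneg_right (hD t ⟨ht.1.le, ht.2⟩) h0

/-- The semigroup law for Riemann–Liouville integrals of continuous functions. -/
theorem integral_sub_rpow_smul_integral_sub_rpow_smul [CompleteSpace X] {p q x y : ℝ}
    (hp : 0 < p) (hq : 0 < q) (hxy : x ≤ y) {g : ℝ → X} (hg : ContinuousOn g (Set.Icc x y)) :
    ∫ t in x..y, (y - t) ^ (p - 1) • ∫ s in x..t, (t - s) ^ (q - 1) • g s
      = ProbabilityTheory.beta q p • ∫ s in x..y, (y - s) ^ (p + q - 1) • g s := by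
  set ν := MeasureTheory.volume.restrict (Set.Ioc x y) with hν
  -- The indicator of `s < t` turns the triangle into the square `(x, y]²`, where Fubini applies to
  -- a product measure.
  let k : ℝ → ℝ → ℝ := fun t s =>
    (Set.Ioi s).indicator (fun t => (y - t) ^ (p - 1) * (t - s) ^ (q - 1)) t
  let F : ℝ × ℝ → X := fun z => k z.1 z.2 • g z.2
  have hkm : Measurable (fun z : ℝ × ℝ => k z.1 z.2) := by
    have : (fun z : ℝ × ℝ => k z.1 z.2) = Set.indicator {z : ℝ × ℝ | z.2 < z.1}
        (fun z => (y - z.1) ^ (p - 1) * (z.1 - z.2) ^ (q - 1)) := by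
      ext z
      simp [k, Set.indicator]
    rw [this]
    refine Measurable.indicator (by fun_prop) (measurableSet_lt measurable_snd measurable_fst)
  obtain ⟨C, hC⟩ := (isCompact_Icc.bddAbove_image hg.norm : BddAbove _)
  have hgm : MeasureTheory.AEStronglyMeasurable g ν :=
    (hg.mono Set.Ioc_subset_Icc_self).aestronglyMeasurable measurableSet_Ioc
  have hFm : MeasureTheory.AEStronglyMeasurable F (ν.prod ν) :=
    hkm.aestronglyMeasurable.smul hgm.comp_snd
  have hk0 : ∀ t ∈ Set.Ioc x y, ∀ s, 0 ≤ k t s := by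
    intro t ht s
    refine Set.indicator_apply_nonneg fun h => ?_
    have h' : s < t := h
    exact mul_nonneg (Real.rpow_nonneg (sub_nonneg.2 ht.2) _) (Real.rpow_nonneg (by linarith) _)
  have hset : ∀ s ∈ Set.Ioc x y, Set.Ioi s ∩ Set.Ioc x y = Set.Ioc s y := by
    intro s hs
    ext t
    simp only [Set.mem_inter_iff, Set.mem_Ioi, Set.mem_Ioc]
    exact ⟨fun h => ⟨h.1, h.2.2⟩, fun h => ⟨h.1, hs.1.trans h.1, h.2⟩⟩
  have hae : ∀ᵐ s ∂ν, s ∈ Set.Ioo x y := by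
    rw [hν, ← MeasureTheory.restrict_Ioo_eq_restrict_Ioc]
    exact MeasureTheory.ae_restrict_mem measurableSet_Ioo
  have hki : ∀ s ∈ Set.Ioo x y, MeasureTheory.Integrable (fun t => k t s) ν := by
    intro s hs
    have := intervalIntegrable_rpow_mul_rpow hp hq hs.2
    rw [intervalIntegrable_iff_integrableOn_Ioc_of_le hs.2.le] at this
    rw [MeasureTheory.integrable_indicator_iff measurableSet_Ioi, hν, MeasureTheory.IntegrableOn,
      MeasureTheory.Measure.restrict_restrict measurableSet_Ioi, hset s ⟨hs.1, hs.2.le⟩]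
    exact this
  have hkint : ∀ s ∈ Set.Ioo x y,
      ∫ t, k t s ∂ν = ProbabilityTheory.beta q p * (y - s) ^ (p + q - 1) := by
    intro s hs
    rw [MeasureTheory.integral_indicator measurableSet_Ioi, hν,
      MeasureTheory.Measure.restrict_restrict measurableSet_Ioi, hset s ⟨hs.1, hs.2.le⟩,
      ← intervalIntegral.integral_of_le hs.2.le, integral_rpow_mul_rpow hp hq hs.2]
  have hFi : MeasureTheory.Integrable F (ν.prod ν) := by
    -- Tonelli with `t` as inner variable: the inner integral of the norm is a Beta constant times
    -- `(y - s)^(p+q-1) ‖g s‖`, integrable because `g` is bounded and `p + q > 0`.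
    rw [MeasureTheory.integrable_prod_iff' hFm]
    constructor
    · filter_upwards [hae] with s hs
      exact (hki s hs).smul_const (g s)
    · have hnorm : (fun s => ∫ t, ‖F (t, s)‖ ∂ν)
          =ᵐ[ν] fun s => (ProbabilityTheory.beta q p * (y - s) ^ (p + q - 1)) * ‖g s‖ := by
        filter_upwards [hae] with s hs
        rw [← hkint s hs, ← MeasureTheory.integral_mul_const]
        refine MeasureTheory.integral_congr_ae ?_
        filter_upwards [MeasureTheory.ae_restrict_mem measurableSet_Ioc] with t ht
        simp only [F]
        rw [norm_smul, Real.norm_of_nonneg (hk0 t ht s)]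
      refine MeasureTheory.Integrable.congr ?_ hnorm.symm
      have h1 := intervalIntegrable_sub_rpow (r := p + q) (by linarith) x y y
      rw [intervalIntegrable_iff_integrableOn_Ioc_of_le hxy] at h1
      refine (h1.const_mul _).mul_bdd (c := C) hgm.norm ?_
      filter_upwards [MeasureTheory.ae_restrict_mem measurableSet_Ioc] with s hs
      rw [norm_norm]
      exact hC ⟨s, Set.Ioc_subset_Icc_self hs, rfl⟩
  have hswap := MeasureTheory.integral_integral_swap (f := fun t s => F (t, s)) hFi
  have hL : ∫ t in x..y, (y - t) ^ (p - 1) • ∫ s in x..t, (t - s) ^ (q - 1) • g s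
      = ∫ t, ∫ s, F (t, s) ∂ν ∂ν := by
    rw [intervalIntegral.integral_of_le hxy]
    refine MeasureTheory.setIntegral_congr_fun measurableSet_Ioc fun t ht => ?_
    rw [intervalIntegral.integral_of_le ht.1.le, ← MeasureTheory.integral_smul]
    have : ∀ s, F (t, s) = (Set.Iio t).indicator
        (fun s => (y - t) ^ (p - 1) • (t - s) ^ (q - 1) • g s) s := by
      intro s
      by_cases h : s < t <;> simp [F, k, h, mul_smul]
    simp_rw [this]
    rw [MeasureTheory.integral_indicator measurableSet_Iio, hν,
      MeasureTheory.Measure.restrict_restrict measurableSet_Iio]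
    have h2 : Set.Iio t ∩ Set.Ioc x y = Set.Ioo x t := by
      ext s
      simp only [Set.mem_inter_iff, Set.mem_Iio, Set.mem_Ioc, Set.mem_Ioo]
      exact ⟨fun h => ⟨h.2.1, h.1⟩, fun h => ⟨h.2, h.1, h.2.le.trans ht.2⟩⟩
    rw [h2, MeasureTheory.restrict_Ioo_eq_restrict_Ioc]
  rw [hL, hswap, intervalIntegral.integral_of_le hxy, ← MeasureTheory.integral_smul]
  refine MeasureTheory.integral_congr_ae ?_
  filter_upwards [hae] with s hs
  simp only [F]
  rw [integral_smul_const, hkint s hs, mul_smul]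

/-! ### Taylor's formula with Caputo remainder. -/

/-- Taylor's formula with integral remainder, with derivatives taken within a fixed interval. -/
theorem eq_taylorWithinEval_add_integral [CompleteSpace X] {a b x y : ℝ} (hab : a < b) {n : ℕ}
    {f : ℝ → X} (hf : ContDiffOn ℝ (n + 1 : ℕ) f (Set.Icc a b)) (hx : x ∈ Set.Icc a b)
    (hy : y ∈ Set.Icc a b) :
    f y = taylorWithinEval f n (Set.Icc a b) x y
      + ∫ t in x..y, ((n ! : ℝ)⁻¹ * (y - t) ^ n) •
          iteratedDerivWithin (n + 1) f (Set.Icc a b) t := by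
  have hs := uniqueDiffOn_Icc hab
  have hsub : Set.uIcc x y ⊆ Set.Icc a b := Set.uIcc_subset_Icc hx hy
  have hf' : ContDiffOn ℝ n f (Set.Icc a b) := hf.of_le (by norm_cast; omega)
  have hd := hf.differentiableOn_iteratedDerivWithin (m := n) (by norm_cast; omega) hs
  have hc := hf.continuousOn_iteratedDerivWithin (m := n + 1) (by norm_cast) hs
  -- The base point moves: as a function of `t`, the Taylor polynomial at `t` evaluated at `y` has a
  -- derivative that telescopes to its top term.
  have h := intervalIntegral.integral_eq_sub_of_hasDeriv_right (a := x) (b := y)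
    (f := fun t => taylorWithinEval f n (Set.Icc a b) t y)
    (f' := fun t => ((n ! : ℝ)⁻¹ * (y - t) ^ n) • iteratedDerivWithin (n + 1) f (Set.Icc a b) t)
    ((continuousOn_taylorWithinEval hs hf').mono hsub)
    (fun t ht => (taylorWithinEval_hasDerivAt_Ioo y hab
      ⟨(le_min hx.1 hy.1).trans_lt ht.1, ht.2.trans_le (max_le hx.2 hy.2)⟩ hf'
      (hd.mono Set.Ioo_subset_Icc_self)).hasDerivWithinAt)
    (ContinuousOn.intervalIntegrable
      (ContinuousOn.smul (by fun_prop) (hc.mono hsub)))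
  rw [h, taylorWithinEval_self]
  abel

variable {a b α : ℝ} {f : ℝ → X} {x y : ℝ}

theorem caputoLeft_self : caputoLeft a b α f x x = 0 := by
  simp [caputoLeft]

theorem caputoRight_self : caputoRight a b α f x x = 0 := by
  simp [caputoRight]

/-- The reflection `t ↦ -t` gives the right derivative the shape of a left one based at `-x`, so one
set of estimates serves both sides. -/
theorem caputoRight_eq (hyx : y ≤ x) :
    caputoRight a b α f x y = ((-1) ^ ⌈α⌉₊ / Real.Gamma ((⌈α⌉₊ : ℝ) - α)) •
      ∫ t in -x..-y, (-y - t) ^ ((⌈α⌉₊ : ℝ) - α - 1) •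
        iteratedDerivWithin ⌈α⌉₊ f (Set.Icc a b) (-t) := by
  rw [caputoRight, if_pos hyx, ← intervalIntegral.integral_comp_neg]
  simp only [neg_neg]
  congr 1
  refine intervalIntegral.integral_congr fun t _ => ?_
  congr 2
  ring

theorem norm_caputo_integral_le {c ν x y M : ℝ} (hν : 0 < ν) (hc : |c| = 1) (hxy : x ≤ y)
    {h : ℝ → X} (hM : ∀ t ∈ Set.Icc x y, ‖h t‖ ≤ M) {d : ℝ} (hd : y - x ≤ d) :
    ‖(c / Real.Gamma ν) • ∫ t in x..y, (y - t) ^ (ν - 1) • h t‖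
      ≤ 1 / Real.Gamma ν * (M * (d ^ ν / ν)) := by
  have hΓ := Real.Gamma_pos_of_pos hν
  have hM0 : 0 ≤ M := (norm_nonneg _).trans (hM x ⟨le_rfl, hxy⟩)
  rw [norm_smul, Real.norm_eq_abs, abs_div, hc, abs_of_pos hΓ]
  refine mul_le_mul_of_nonneg_left ((norm_integral_sub_rpow_smul_le hν hxy hM).trans ?_)
    (by positivity)
  have := Real.rpow_le_rpow (sub_nonneg.2 hxy) hd hν.le
  gcongr

theorem exists_caputo_bound (hab : a < b) (hα : α < ⌈α⌉₊)
    (hf : ContDiffOn ℝ (⌈α⌉₊ : ℕ) f (Set.Icc a b)) :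
    ∃ C : ℝ, ∀ x ∈ Set.Icc a b,
      (∀ y ∈ Set.Icc a x, ‖caputoRight a b α f x y‖ ≤ C) ∧
      (∀ y ∈ Set.Icc x b, ‖caputoLeft a b α f x y‖ ≤ C) := by
  have hc := hf.continuousOn_iteratedDerivWithin (m := ⌈α⌉₊) le_rfl (uniqueDiffOn_Icc hab)
  obtain ⟨M, hM⟩ := (isCompact_Icc.bddAbove_image hc.norm : BddAbove _)
  have hM' : ∀ t ∈ Set.Icc a b, ‖iteratedDerivWithin ⌈α⌉₊ f (Set.Icc a b) t‖ ≤ M :=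
    fun t ht => hM ⟨t, ht, rfl⟩
  refine ⟨1 / Real.Gamma (⌈α⌉₊ - α) * (M * ((b - a) ^ (⌈α⌉₊ - α) / (⌈α⌉₊ - α))),
    fun x hx => ⟨fun y hy => ?_, fun y hy => ?_⟩⟩
  · rw [caputoRight_eq hy.2]
    refine norm_caputo_integral_le (d := b - a) (sub_pos.2 hα) (by simp) (neg_le_neg hy.2)
      (fun t ht => hM' _ ⟨?_, ?_⟩) ?_
    · linarith [ht.2, hy.1]
    · linarith [ht.1, hx.2]
    · linarith [hy.1, hx.2]
  · rw [caputoLeft, if_pos hy.1]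
    refine norm_caputo_integral_le (sub_pos.2 hα) (by simp) hy.1
      (fun t ht => hM' _ ⟨hx.1.trans ht.1, ht.2.trans hy.2⟩) ?_
    linarith [hx.1, hy.2]

/-- The semigroup law produces `B(ν, α) = Γ(ν) Γ(α) / Γ(n + 1)`; both prefactors cancel and leave
the classical kernel with `1 / n!`. The sign `c` is `1` on the left and `(-1)^N` on the right. -/
theorem integral_sub_rpow_smul_caputo_integral [CompleteSpace X] {c ν : ℝ} {n : ℕ} (hα : 0 < α)
    (hν : 0 < ν) (hn : α + ν = n + 1) (hxy : x ≤ y) {h : ℝ → X}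
    (hh : ContinuousOn h (Set.Icc x y)) :
    (1 / Real.Gamma α) • ∫ t in x..y, (y - t) ^ (α - 1) •
        ((c / Real.Gamma ν) • ∫ s in x..t, (t - s) ^ (ν - 1) • h s)
      = c • ∫ s in x..y, ((n ! : ℝ)⁻¹ * (y - s) ^ n) • h s := by
  simp_rw [smul_comm _ (c / Real.Gamma ν)]
  rw [intervalIntegral.integral_smul,
    integral_sub_rpow_smul_integral_sub_rpow_smul hα hν hxy hh, smul_smul, smul_smul, hn,
    ← intervalIntegral.integral_smul, ← intervalIntegral.integral_smul]
  refine intervalIntegral.integral_congr fun s _ => ?_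
  simp only [smul_smul]
  rw [add_sub_cancel_right, Real.rpow_natCast, ProbabilityTheory.beta, add_comm ν, hn,
    Real.Gamma_nat_eq_factorial]
  congr 1
  have h1 := (Real.Gamma_pos_of_pos hα).ne'
  have h2 := (Real.Gamma_pos_of_pos hν).ne'
  field_simp

/-- The Caputo form of Taylor's formula, to the right of the base point. -/
theorem sub_taylorWithinEval_eq_caputoLeft [CompleteSpace X] (hab : a < b) (hα : 0 < α)
    (hαN : α < ⌈α⌉₊) {n : ℕ} (hn : ⌈α⌉₊ = n + 1)
    (hf : ContDiffOn ℝ (⌈α⌉₊ : ℕ) f (Set.Icc a b)) (hx : x ∈ Set.Icc a b) (hy : y ∈ Set.Icc x b) :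
    f y - taylorWithinEval f n (Set.Icc a b) x y
      = (1 / Real.Gamma α) • ∫ t in x..y, (y - t) ^ (α - 1) • caputoLeft a b α f x t := by
  have hc := hf.continuousOn_iteratedDerivWithin (m := ⌈α⌉₊) le_rfl (uniqueDiffOn_Icc hab)
  have h1 := integral_sub_rpow_smul_caputo_integral (c := 1) (ν := ⌈α⌉₊ - α) (n := n) hα
    (sub_pos.2 hαN) (by rw [hn]; push_cast; ring) hy.1 (hc.mono (Set.Icc_subset_Icc hx.1 hy.2))
  have h2 := eq_taylorWithinEval_add_integral hab (n := n) (by rwa [← hn]) hx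
    ⟨hx.1.trans hy.1, hy.2⟩
  rw [one_smul] at h1
  rw [h2, add_sub_cancel_left, ← hn, ← h1]
  congr 1
  refine intervalIntegral.integral_congr fun t ht => ?_
  rw [Set.uIcc_of_le hy.1] at ht
  simp only [caputoLeft, if_pos ht.1]

/-- The Caputo form of Taylor's formula, to the left of the base point. -/
theorem sub_taylorWithinEval_eq_caputoRight [CompleteSpace X] (hab : a < b) (hα : 0 < α)
    (hαN : α < ⌈α⌉₊) {n : ℕ} (hn : ⌈α⌉₊ = n + 1)
    (hf : ContDiffOn ℝ (⌈α⌉₊ : ℕ) f (Set.Icc a b)) (hx : x ∈ Set.Icc a b) (hy : y ∈ Set.Icc a x) :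
    f y - taylorWithinEval f n (Set.Icc a b) x y
      = (1 / Real.Gamma α) •
        ∫ t in -x..-y, (-y - t) ^ (α - 1) • caputoRight a b α f x (-t) := by
  have hc := hf.continuousOn_iteratedDerivWithin (m := ⌈α⌉₊) le_rfl (uniqueDiffOn_Icc hab)
  have h1 := integral_sub_rpow_smul_caputo_integral (c := (-1) ^ ⌈α⌉₊) (ν := ⌈α⌉₊ - α) (n := n) hα
    (sub_pos.2 hαN) (by rw [hn]; push_cast; ring) (neg_le_neg hy.2)
    (h := fun t => iteratedDerivWithin ⌈α⌉₊ f (Set.Icc a b) (-t))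
    (hc.comp continuousOn_neg fun t ht => ⟨by linarith [ht.2, hy.1], by linarith [ht.1, hx.2]⟩)
  have h2 := eq_taylorWithinEval_add_integral hab (n := n) (by rwa [← hn]) hx
    ⟨hy.1, hy.2.trans hx.2⟩
  have h3 : ∫ t in -x..-y, (-y - t) ^ (α - 1) • caputoRight a b α f x (-t)
      = ∫ t in -x..-y, (-y - t) ^ (α - 1) •
        (((-1) ^ ⌈α⌉₊ / Real.Gamma (⌈α⌉₊ - α)) • ∫ s in -x..t, (t - s) ^ ((⌈α⌉₊ : ℝ) - α - 1) •
          iteratedDerivWithin ⌈α⌉₊ f (Set.Icc a b) (-s)) := by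
    refine intervalIntegral.integral_congr fun t ht => ?_
    rw [Set.uIcc_of_le (neg_le_neg hy.2)] at ht
    rw [caputoRight_eq (by linarith [ht.1]), neg_neg]
  rw [h3, h1, h2, add_sub_cancel_left, ← hn, intervalIntegral.integral_symm,
    ← intervalIntegral.integral_smul, ← intervalIntegral.integral_neg]
  have h4 := intervalIntegral.integral_comp_neg (a := -x) (b := -y)
    (fun t => -(((n ! : ℝ)⁻¹ * (y - t) ^ n) • iteratedDerivWithin ⌈α⌉₊ f (Set.Icc a b) t))
  rw [neg_neg, neg_neg] at h4
  rw [← h4]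
  refine intervalIntegral.integral_congr fun t _ => ?_
  simp only [smul_smul]
  rw [← neg_smul]
  congr 1
  -- The sign `(-1)^(n+1)` is accounted for by one factor from reversing the orientation of the
  -- integral and `n` factors from the kernel.
  have h5 : y - -t = (-1) * (-y - t) := by ring
  rw [h5, mul_pow, hn, pow_succ]
  ring

/-- `K` is left free, and the bound on the derivative is asked only up to `y`, so that `K` can be a
modulus of continuity for near `y` and a sup norm for far `y`. -/
theorem norm_sub_taylorWithinEval_le_of_caputoLeft [CompleteSpace X] (hab : a < b) (hα : 0 < α)
    (hαN : α < ⌈α⌉₊) {n : ℕ} (hn : ⌈α⌉₊ = n + 1)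
    (hf : ContDiffOn ℝ (⌈α⌉₊ : ℕ) f (Set.Icc a b)) (hx : x ∈ Set.Icc a b) (hy : y ∈ Set.Icc x b)
    {K : ℝ} (hK : ∀ t ∈ Set.Icc x y, ‖caputoLeft a b α f x t‖ ≤ K) :
    ‖f y - taylorWithinEval f n (Set.Icc a b) x y‖
      ≤ K * (y - x) ^ α / Real.Gamma (α + 1) := by
  have hΓ := Real.Gamma_pos_of_pos hα
  rw [sub_taylorWithinEval_eq_caputoLeft hab hα hαN hn hf hx hy, norm_smul,
    Real.norm_of_nonneg (by positivity), Real.Gamma_add_one hα.ne']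
  refine (mul_le_mul_of_nonneg_left (norm_integral_sub_rpow_smul_le hα hy.1 hK)
    (by positivity)).trans_eq ?_
  field_simp

theorem norm_sub_taylorWithinEval_le_of_caputoRight [CompleteSpace X] (hab : a < b) (hα : 0 < α)
    (hαN : α < ⌈α⌉₊) {n : ℕ} (hn : ⌈α⌉₊ = n + 1)
    (hf : ContDiffOn ℝ (⌈α⌉₊ : ℕ) f (Set.Icc a b)) (hx : x ∈ Set.Icc a b) (hy : y ∈ Set.Icc a x)
    {K : ℝ} (hK : ∀ t ∈ Set.Icc y x, ‖caputoRight a b α f x t‖ ≤ K) :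
    ‖f y - taylorWithinEval f n (Set.Icc a b) x y‖
      ≤ K * (x - y) ^ α / Real.Gamma (α + 1) := by
  have hΓ := Real.Gamma_pos_of_pos hα
  rw [sub_taylorWithinEval_eq_caputoRight hab hα hαN hn hf hx hy, norm_smul,
    Real.norm_of_nonneg (by positivity), Real.Gamma_add_one hα.ne']
  refine (mul_le_mul_of_nonneg_left (norm_integral_sub_rpow_smul_le hα (neg_le_neg hy.2)
    fun t ht => hK _ ⟨by linarith [ht.2], by linarith [ht.1]⟩) (by positivity)).trans_eq ?_
  rw [show -y - -x = x - y by ring]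
  field_simp

end

/-! ### The sigmoid and its density: monotonicity, tails, lower bound. -/

section Sigmoid

variable {m : ℕ}

theorem one_add_pow_two_mul_pos (m : ℕ) (x : ℝ) : 0 < 1 + x ^ (2 * m) := by
  have := (even_two_mul m).pow_nonneg x
  linarith

theorem algSigmoid_neg (m : ℕ) (x : ℝ) : algSigmoid m (-x) = -algSigmoid m x := by
  rw [algSigmoid, algSigmoid, (even_two_mul m).neg_pow, neg_div]

theorem algDensity_neg (m : ℕ) (x : ℝ) : algDensity m (-x) = algDensity m x := by
  rw [algDensity, algDensity, show -x + 1 = -(x - 1) by ring, show -x - 1 = -(x + 1) by ring,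
    algSigmoid_neg, algSigmoid_neg]
  ring

/-- In this form `x` occurs once, so monotonicity on the half-line and the bound by `1` can be read
off. -/
theorem algSigmoid_eq_rpow (hm : 1 ≤ m) {x : ℝ} (hx : 0 ≤ x) :
    algSigmoid m x = (1 - 1 / (1 + x ^ (2 * m))) ^ (1 / (2 * (m : ℝ))) := by
  have h := one_add_pow_two_mul_pos m x
  have hm' : 2 * m ≠ 0 := by omega
  rw [show 1 - 1 / (1 + x ^ (2 * m)) = x ^ (2 * m) / (1 + x ^ (2 * m)) by field_simp; ring,
    Real.div_rpow (by positivity) h.le, algSigmoid]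
  congr 1
  rw [show 1 / (2 * (m : ℝ)) = ((2 * m : ℕ) : ℝ)⁻¹ by push_cast; rw [one_div],
    Real.pow_rpow_inv_natCast hx hm']

theorem algSigmoid_nonneg {x : ℝ} (hx : 0 ≤ x) : 0 ≤ algSigmoid m x :=
  div_nonneg hx (Real.rpow_nonneg (one_add_pow_two_mul_pos m x).le _)

theorem algSigmoid_mono (hm : 1 ≤ m) : Monotone (algSigmoid m) := by
  have h0 : ∀ x y : ℝ, 0 ≤ x → x ≤ y → algSigmoid m x ≤ algSigmoid m y := by
    intro x y hx hxy
    have h1 : 1 / (1 + x ^ (2 * m)) ≤ 1 := by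
      rw [div_le_one (one_add_pow_two_mul_pos m x)]
      linarith [pow_nonneg hx (2 * m)]
    have h2 : 1 / (1 + y ^ (2 * m)) ≤ 1 / (1 + x ^ (2 * m)) :=
      one_div_le_one_div_of_le (one_add_pow_two_mul_pos m x) (by gcongr)
    rw [algSigmoid_eq_rpow hm hx, algSigmoid_eq_rpow hm (hx.trans hxy)]
    exact Real.rpow_le_rpow (by linarith) (by linarith) (by positivity)
  intro x y hxy
  rcases le_total 0 x with hx | hx
  · exact h0 x y hx hxy
  · rcases le_total 0 y with hy | hy
    · have h1 := algSigmoid_nonneg (m := m) (neg_nonneg.2 hx)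
      rw [algSigmoid_neg] at h1
      linarith [algSigmoid_nonneg (m := m) hy]
    · have h1 := h0 (-y) (-x) (by linarith) (by linarith)
      rw [algSigmoid_neg, algSigmoid_neg] at h1
      linarith

theorem algDensity_nonneg (hm : 1 ≤ m) (x : ℝ) : 0 ≤ algDensity m x := by
  have := algSigmoid_mono hm (show x - 1 ≤ x + 1 by linarith)
  rw [algDensity]
  linarith

theorem algSigmoid_le_one (hm : 1 ≤ m) (x : ℝ) : algSigmoid m x ≤ 1 := by
  refine (algSigmoid_mono hm (le_abs_self x)).trans ?_
  rw [algSigmoid_eq_rpow hm (abs_nonneg x)]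
  have h := one_add_pow_two_mul_pos m |x|
  refine Real.rpow_le_one ?_ ?_ (by positivity)
  · rw [sub_nonneg, div_le_one h]
    linarith [pow_nonneg (abs_nonneg x) (2 * m)]
  · linarith [one_div_pos.2 h]

/-- With `v = x^(-2m)` and `p = 1/(2m) ≤ 1` one has `φ(x) = (1 + v)^(-p)`. Bernoulli gives `(1 +
v)^p ≤ 1 + p v`, and `1 / (1 + p v) ≥ 1 - p v`. -/
theorem one_sub_algSigmoid_le (hm : 1 ≤ m) {x : ℝ} (hx : 0 < x) :
    1 - algSigmoid m x ≤ 1 / (2 * m * x ^ (2 * m)) := by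
  have hm' : 2 * m ≠ 0 := by omega
  have hm1 : (1 : ℝ) ≤ m := by exact_mod_cast hm
  set v := 1 / x ^ (2 * m) with hv
  have hv0 : 0 < v := by positivity
  set p := 1 / (2 * (m : ℝ)) with hp
  have h1 : (1 + x ^ (2 * m)) ^ p = x * (1 + v) ^ p := by
    rw [show 1 + x ^ (2 * m) = x ^ (2 * m) * (1 + v) by rw [hv]; field_simp; ring,
      Real.mul_rpow (by positivity) (by positivity)]
    congr 1
    rw [hp, show 1 / (2 * (m : ℝ)) = ((2 * m : ℕ) : ℝ)⁻¹ by push_cast; rw [one_div],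
      Real.pow_rpow_inv_natCast hx.le hm']
  have hp1 : p ≤ 1 := by
    rw [hp, div_le_one (by positivity)]
    linarith
  have h2 : (1 + v) ^ p ≤ 1 + p * v :=
    rpow_one_add_le_one_add_mul_self (by linarith) (by positivity) hp1
  have h3 : algSigmoid m x = 1 / (1 + v) ^ p := by
    rw [algSigmoid, h1]
    field_simp
  have h4 : 1 / (1 + p * v) ≤ algSigmoid m x := by
    rw [h3]
    exact one_div_le_one_div_of_le (by positivity) h2
  have h5 : 1 - p * v ≤ 1 / (1 + p * v) := by
    rw [le_div_iff₀ (by positivity)]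
    nlinarith [sq_nonneg (p * v)]
  have h6 : 1 / (2 * m * x ^ (2 * m)) = p * v := by
    rw [hp, hv]
    field_simp
  rw [h6]
  linarith

/-- The origin of the constant in every estimate: `φ(0) = 0`, so only `φ(2) / 4` remains. -/
theorem algDensity_one (m : ℕ) :
    algDensity m 1 = (2 * (1 + 4 ^ m : ℝ) ^ (1 / (2 * (m : ℝ))))⁻¹ := by
  rw [algDensity, sub_self, algSigmoid, algSigmoid, zero_div, sub_zero, pow_mul, mul_inv]
  norm_num
  ring

/-- By oddness `4 Φ(x) = φ(1 + x) + φ(1 - x)`. Both arguments lie in `[0, 2]` and add up to `2`, so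
the chord bounds `φ(y) ≥ (y / 2) φ(2)` add up to `φ(2) = 4 Φ(1)`. -/
theorem algDensity_one_le (hm : 1 ≤ m) {x : ℝ} (hx : |x| ≤ 1) :
    algDensity m 1 ≤ algDensity m x := by
  have hpos : ∀ y : ℝ, 0 < (1 + y ^ (2 * m)) ^ (1 / (2 * (m : ℝ))) := fun y =>
    Real.rpow_pos_of_pos (one_add_pow_two_mul_pos m y) _
  -- `φ y / y` is decreasing in `y`
  have key : ∀ y : ℝ, 0 ≤ y → y ≤ 2 → y / 2 * algSigmoid m 2 ≤ algSigmoid m y := by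
    intro y hy hy2
    have h1 : (1 + y ^ (2 * m)) ^ (1 / (2 * (m : ℝ))) ≤ (1 + 2 ^ (2 * m)) ^ (1 / (2 * (m : ℝ))) :=
      Real.rpow_le_rpow (one_add_pow_two_mul_pos m y).le (by gcongr) (by positivity)
    rw [algSigmoid, algSigmoid]
    calc y / 2 * (2 / (1 + 2 ^ (2 * m)) ^ (1 / (2 * (m : ℝ))))
        = y / (1 + 2 ^ (2 * m)) ^ (1 / (2 * (m : ℝ))) := by ring
      _ ≤ _ := div_le_div_of_nonneg_left hy (hpos y) h1
  rw [abs_le] at hx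
  have h1 := key (1 + x) (by linarith) (by linarith)
  have h2 := key (1 - x) (by linarith) (by linarith)
  have h3 : algSigmoid m 0 = 0 := by simp [algSigmoid]
  rw [algDensity, algDensity, show x - 1 = -(1 - x) by ring, algSigmoid_neg, sub_self, h3,
    add_comm x 1, one_add_one_eq_two]
  linarith

/-- The differences have step two, so two terms survive at each end. -/
theorem sum_range_algDensity (m : ℕ) (u : ℝ) (M : ℕ) :
    ∑ i ∈ Finset.range M, algDensity m (u + i)
      = 1 / 4 * (algSigmoid m (u + M) + algSigmoid m (u + M - 1)
          - algSigmoid m u - algSigmoid m (u - 1)) := by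
  induction M with
  | zero => simp
  | succ M ih =>
    rw [Finset.sum_range_succ, ih, algDensity]
    push_cast
    rw [← add_assoc, add_sub_cancel_right]
    ring

/-- After enlarging `S` to a run of consecutive integers from `K = ⌈x + T⌉`, the sum telescopes. The
upper two values of `φ` are at most `1`, leaving a quarter of `1 - φ` at `K - x` and at `K - x - 1`;
the second point is only known to be at least `T - 1`, hence the shift. -/
theorem sum_algDensity_right_le (hm : 1 ≤ m) {T : ℝ} (hT : 1 < T) (x : ℝ) (S : Finset ℤ)
    (hS : ∀ k ∈ S, T ≤ k - x) :
    ∑ k ∈ S, algDensity m (x - k) ≤ 1 / (4 * m * (T - 1) ^ (2 * m)) := by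
  have hm1 : (1 : ℝ) ≤ m := by exact_mod_cast hm
  set K := ⌈x + T⌉ with hK
  have hKS : ∀ k ∈ S, K ≤ k := fun k hk => Int.ceil_le.2 (by linarith [hS k hk])
  have hKT : T ≤ K - x := by linarith [Int.le_ceil (x + T)]
  have h1 : ∑ k ∈ S, algDensity m (x - k)
      = ∑ i ∈ S.image (fun k => (k - K).toNat), algDensity m (K - x + i) := by
    rw [Finset.sum_image]
    · refine Finset.sum_congr rfl fun k hk => ?_
      have : (((k - K).toNat : ℕ) : ℝ) = k - K := by
        have := Int.toNat_of_nonneg (sub_nonneg.2 (hKS k hk))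
        exact_mod_cast congrArg (Int.cast : ℤ → ℝ) this
      rw [this, ← algDensity_neg]
      congr 1
      ring
    · intro k hk l hl h
      have := hKS k hk
      have := hKS l hl
      simp only at h
      omega
  rw [h1]
  refine (Finset.sum_le_sum_of_subset_of_nonneg (Finset.subset_range_sup_succ _)
    fun _ _ _ => algDensity_nonneg hm _).trans ?_
  rw [sum_range_algDensity]
  have h2 := one_sub_algSigmoid_le hm (x := K - x) (by linarith)
  have h3 := one_sub_algSigmoid_le hm (x := K - x - 1) (by linarith)
  have hb : ∀ u : ℝ, T - 1 ≤ u → 1 / (2 * m * u ^ (2 * m)) ≤ 1 / (2 * m * (T - 1) ^ (2 * m)) := by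
    intro u hu
    have h0 : 0 < T - 1 := by linarith
    refine one_div_le_one_div_of_le (by positivity) ?_
    gcongr
  have h4 := hb (K - x) (by linarith)
  have h5 := hb (K - x - 1) (by linarith)
  have h6 : 1 / (4 * (m : ℝ) * (T - 1) ^ (2 * m)) = 1 / 2 * (1 / (2 * m * (T - 1) ^ (2 * m))) := by
    have h0 : 0 < T - 1 := by linarith
    field_simp
    norm_num
  rw [h6]
  linarith [algSigmoid_le_one hm (K - x + ((S.image fun k => (k - K).toNat).sup id).succ),
    algSigmoid_le_one hm (K - x + ((S.image fun k => (k - K).toNat).sup id).succ - 1)]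

theorem sum_algDensity_left_le (hm : 1 ≤ m) {T : ℝ} (hT : 1 < T) (x : ℝ) (S : Finset ℤ)
    (hS : ∀ k ∈ S, T ≤ x - k) :
    ∑ k ∈ S, algDensity m (x - k) ≤ 1 / (4 * m * (T - 1) ^ (2 * m)) := by
  refine le_trans (le_of_eq ?_) (sum_algDensity_right_le hm hT (-x) (S.image Neg.neg) ?_)
  · rw [Finset.sum_image neg_injective.injOn]
    refine Finset.sum_congr rfl fun k _ => ?_
    rw [← algDensity_neg]
    congr 1
    push_cast
    ring
  · intro k hk
    obtain ⟨l, hl, rfl⟩ := Finset.mem_image.1 hk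
    push_cast
    linarith [hS l hl]

/-- One node within distance `1` of `x` is enough, the terms being nonnegative: `⌊x⌋` when it is in
range, and `⌈c⌉` otherwise. -/
theorem algDensity_one_le_sum (hm : 1 ≤ m) {c d x : ℝ} (hcd : ⌈c⌉ ≤ ⌊d⌋)
    (hx : x ∈ Set.Icc c d) :
    algDensity m 1 ≤ ∑ k ∈ Finset.Icc ⌈c⌉ ⌊d⌋, algDensity m (x - (k : ℝ)) := by
  obtain ⟨k, hk, hkx⟩ : ∃ k ∈ Finset.Icc ⌈c⌉ ⌊d⌋, |x - (k : ℝ)| ≤ 1 := by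
    rcases le_total ⌈c⌉ ⌊x⌋ with h | h
    · refine ⟨⌊x⌋, Finset.mem_Icc.2 ⟨h, Int.floor_le_floor hx.2⟩, ?_⟩
      rw [abs_le]
      constructor <;> linarith [Int.floor_le x, Int.lt_floor_add_one x]
    · refine ⟨⌈c⌉, Finset.mem_Icc.2 ⟨le_rfl, hcd⟩, ?_⟩
      have : (⌊x⌋ : ℝ) ≤ ⌈c⌉ := by exact_mod_cast h
      rw [abs_le]
      constructor <;> linarith [Int.ceil_lt_add_one c, Int.lt_floor_add_one x, hx.1]
  exact (algDensity_one_le hm hkx).trans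
    (Finset.single_le_sum (f := fun k : ℤ => algDensity m (x - (k : ℝ)))
      (fun _ _ => algDensity_nonneg hm _) hk)

theorem one_le_two_mul_rpow (m : ℕ) : 1 ≤ 2 * (1 + 4 ^ m : ℝ) ^ (1 / (2 * (m : ℝ))) := by
  have h : (1 : ℝ) ≤ (1 + 4 ^ m : ℝ) ^ (1 / (2 * (m : ℝ))) :=
    Real.one_le_rpow (by linarith [pow_nonneg (show (0 : ℝ) ≤ 4 by norm_num) m]) (by positivity)
  linarith

end Sigmoid

/-! ### Norm bound for the operator and its action on Taylor polynomials. -/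

section Operator

variable {V : Type*} [NormedAddCommGroup V] [NormedSpace ℝ V] {m n : ℕ} {a b x : ℝ}

theorem natCast_pos_of_two_lt_rpow {r : ℝ} (hr : 0 < r) (hn : 2 < (n : ℝ) ^ r) : 0 < (n : ℝ) := by
  rcases Nat.eq_zero_or_pos n with rfl | h
  · rw [Nat.cast_zero, Real.zero_rpow hr.ne'] at hn
    linarith
  · exact_mod_cast h

theorem div_mem_Icc_of_mem_ceil_floor (hn : 0 < (n : ℝ)) {k : ℤ}
    (hk : k ∈ Finset.Icc ⌈(n : ℝ) * a⌉ ⌊(n : ℝ) * b⌋) : (k : ℝ) / n ∈ Set.Icc a b := by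
  rw [Finset.mem_Icc, Int.ceil_le, Int.le_floor] at hk
  exact ⟨by rw [le_div_iff₀ hn]; linarith, by rw [div_le_iff₀ hn]; linarith⟩

/-- Nodes are split by `|nx - k| < T`, which is `|k/n - x| < n^{-β}`. Near nodes contribute at most
`A` to the average; the far nodes on each side have total weight at most `τ` before normalisation.
Treating the sides separately keeps `B` and `C` apart. -/
theorem norm_neuralOp_le (hm : 1 ≤ m) {β : ℝ} (hβ1 : β < 1)
    (hn : 2 < (n : ℝ) ^ (1 - β)) (hab : ⌈(n : ℝ) * a⌉ ≤ ⌊(n : ℝ) * b⌋) (hx : x ∈ Set.Icc a b)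
    {h : ℝ → V} {A B C : ℝ} (hA : 0 ≤ A) (hB : 0 ≤ B) (hC : 0 ≤ C)
    (hnear : ∀ y ∈ Set.Icc a b, |y - x| ≤ 1 / (n : ℝ) ^ β → ‖h y‖ ≤ A)
    (hleft : ∀ y ∈ Set.Icc a x, ‖h y‖ ≤ B) (hright : ∀ y ∈ Set.Icc x b, ‖h y‖ ≤ C) :
    ‖neuralOp m a b n h x‖ ≤ 2 * (1 + 4 ^ m : ℝ) ^ (1 / (2 * (m : ℝ))) *
      (A + (B + C) / (4 * (m : ℝ) * ((n : ℝ) ^ (1 - β) - 2) ^ (2 * m))) := by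
  have hm1 : (1 : ℝ) ≤ m := by exact_mod_cast hm
  have hn0 : 0 < (n : ℝ) := natCast_pos_of_two_lt_rpow (sub_pos.2 hβ1) hn
  set I := Finset.Icc ⌈(n : ℝ) * a⌉ ⌊(n : ℝ) * b⌋ with hI
  set w : ℤ → ℝ := fun k => algDensity m ((n : ℝ) * x - (k : ℝ)) with hw
  set c := 2 * (1 + 4 ^ m : ℝ) ^ (1 / (2 * (m : ℝ))) with hc
  set T := (n : ℝ) ^ (1 - β) with hT
  set τ := 1 / (4 * (m : ℝ) * (T - 2) ^ (2 * m)) with hτ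
  have hτ0 : 0 ≤ τ := by
    have : 0 < T - 2 := by linarith
    positivity
  have hc1 : 1 ≤ c := one_le_two_mul_rpow m
  have hw0 : ∀ k, 0 ≤ w k := fun k => algDensity_nonneg hm _
  have hV : c⁻¹ ≤ ∑ k ∈ I, w k := by
    rw [hc, ← algDensity_one]
    exact algDensity_one_le_sum hm hab
      ⟨mul_le_mul_of_nonneg_left hx.1 hn0.le, mul_le_mul_of_nonneg_left hx.2 hn0.le⟩
  have hV0 : 0 < ∑ k ∈ I, w k := lt_of_lt_of_le (inv_pos.2 (by linarith)) hV
  have hVinv : (∑ k ∈ I, w k)⁻¹ ≤ c := inv_le_of_inv_le₀ (by linarith) hV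
  have hTn : T = n * (1 / (n : ℝ) ^ β) := by
    rw [hT, Real.rpow_sub hn0, Real.rpow_one]
    ring
  -- The tail lemmas give `T - 1`; the weaker `T - 2` is what the target asks for.
  have hτ1 : 1 / (4 * (m : ℝ) * (T - 1) ^ (2 * m)) ≤ τ := by
    have : 0 < T - 2 := by linarith
    refine one_div_le_one_div_of_le (by positivity) ?_
    gcongr
    norm_num
  set R := I.filter (fun k : ℤ => T ≤ k - n * x) with hR
  set L := I.filter (fun k : ℤ => T ≤ n * x - k) with hL
  have hRs : ∑ k ∈ R, w k ≤ τ :=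
    (sum_algDensity_right_le hm (by linarith) _ R fun k hk => (Finset.mem_filter.1 hk).2).trans hτ1
  have hLs : ∑ k ∈ L, w k ≤ τ :=
    (sum_algDensity_left_le hm (by linarith) _ L fun k hk => (Finset.mem_filter.1 hk).2).trans hτ1
  have hpt : ∀ k ∈ I, ‖h ((k : ℝ) / n)‖ ≤ A + (if T ≤ n * x - (k : ℝ) then B else 0)
      + (if T ≤ (k : ℝ) - n * x then C else 0) := by
    intro k hk
    have hy := div_mem_Icc_of_mem_ceil_floor hn0 hk
    have hk' : (k : ℝ) = n * ((k : ℝ) / n) := by field_simp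
    have hB' : 0 ≤ (if T ≤ n * x - (k : ℝ) then B else 0) := by split_ifs <;> simp [hB]
    have hC' : 0 ≤ (if T ≤ (k : ℝ) - n * x then C else 0) := by split_ifs <;> simp [hC]
    by_cases h1 : T ≤ n * x - (k : ℝ)
    · have h2 := hleft ((k : ℝ) / n) ⟨hy.1, by rw [div_le_iff₀ hn0]; linarith⟩
      rw [if_pos h1]
      linarith
    · by_cases h2 : T ≤ (k : ℝ) - n * x
      · have h3 := hright ((k : ℝ) / n) ⟨by rw [le_div_iff₀ hn0]; linarith, hy.2⟩
        rw [if_pos h2]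
        linarith
      · have h3 := hnear ((k : ℝ) / n) hy (by
          rw [← mul_le_mul_iff_right₀ hn0, ← hTn, ← abs_of_pos hn0, ← abs_mul, abs_of_pos hn0,
            mul_sub, ← hk', abs_le]
          constructor <;> linarith)
        linarith
  have hmain : ∑ k ∈ I, w k * ‖h ((k : ℝ) / n)‖
      ≤ (∑ k ∈ I, w k) * A + (∑ k ∈ L, w k) * B + (∑ k ∈ R, w k) * C := by
    rw [hL, hR, Finset.sum_filter, Finset.sum_filter, Finset.sum_mul, Finset.sum_mul,
      Finset.sum_mul, ← Finset.sum_add_distrib, ← Finset.sum_add_distrib]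
    refine Finset.sum_le_sum fun k hk => (mul_le_mul_of_nonneg_left (hpt k hk) (hw0 k)).trans_eq ?_
    split_ifs <;> ring
  have hfar : (∑ k ∈ L, w k) * B + (∑ k ∈ R, w k) * C ≤ τ * (B + C) := by
    rw [mul_add]
    exact add_le_add (mul_le_mul_of_nonneg_right hLs hB) (mul_le_mul_of_nonneg_right hRs hC)
  calc ‖neuralOp m a b n h x‖
      ≤ (∑ k ∈ I, w k)⁻¹ * ∑ k ∈ I, w k * ‖h ((k : ℝ) / n)‖ := by
        rw [neuralOp, norm_smul, Real.norm_of_nonneg (inv_nonneg.2 hV0.le)]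
        refine mul_le_mul_of_nonneg_left ((norm_sum_le _ _).trans_eq ?_) (inv_nonneg.2 hV0.le)
        refine Finset.sum_congr rfl fun k _ => ?_
        rw [norm_smul, Real.norm_of_nonneg (hw0 k)]
    _ ≤ (∑ k ∈ I, w k)⁻¹ * ((∑ k ∈ I, w k) * A + τ * (B + C)) :=
        mul_le_mul_of_nonneg_left (by linarith) (inv_nonneg.2 hV0.le)
    _ = A + (∑ k ∈ I, w k)⁻¹ * (τ * (B + C)) := by
        rw [mul_add, inv_mul_cancel_left₀ hV0.ne']
    -- The near part needs no constant; `A ≤ c * A` holds because `1 ≤ c`.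
    _ ≤ c * A + c * (τ * (B + C)) := by
        have h1 : 0 ≤ τ * (B + C) := by positivity
        have h2 := mul_le_mul_of_nonneg_right hVinv h1
        nlinarith
    _ = c * (A + (B + C) / (4 * (m : ℝ) * (T - 2) ^ (2 * m))) := by
        rw [hτ]
        ring

/-- Linearity, plus reproduction of constants for the zeroth Taylor term; the latter needs the
normalising sum to be nonzero. -/
theorem neuralOp_sub_taylorWithinEval (hm : 1 ≤ m) (hn : 0 < (n : ℝ))
    (hab : ⌈(n : ℝ) * a⌉ ≤ ⌊(n : ℝ) * b⌋) (hx : x ∈ Set.Icc a b) (f : ℝ → V) (N : ℕ) :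
    neuralOp m a b n (fun y => f y - taylorWithinEval f N (Set.Icc a b) x y) x
      = neuralOp m a b n f x
        - (∑ j ∈ Finset.Icc 1 N, neuralOp m a b n (fun t : ℝ => (t - x) ^ j) x •
            ((1 / (j ! : ℝ)) • iteratedDerivWithin j f (Set.Icc a b) x))
        - f x := by
  have hV := algDensity_one_le_sum hm hab (x := n * x)
      ⟨mul_le_mul_of_nonneg_left hx.1 hn.le, mul_le_mul_of_nonneg_left hx.2 hn.le⟩
  have hV0 : 0 < ∑ k ∈ Finset.Icc ⌈(n : ℝ) * a⌉ ⌊(n : ℝ) * b⌋,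
      algDensity m ((n : ℝ) * x - (k : ℝ)) := by
    refine lt_of_lt_of_le ?_ hV
    rw [algDensity_one]
    exact inv_pos.2 (by linarith [one_le_two_mul_rpow m])
  have ht : ∀ y, taylorWithinEval f N (Set.Icc a b) x y = f x + ∑ j ∈ Finset.Icc 1 N,
      (y - x) ^ j • ((1 / (j ! : ℝ)) • iteratedDerivWithin j f (Set.Icc a b) x) := by
    intro y
    rw [taylor_within_apply, Finset.range_eq_Ico, Finset.sum_eq_sum_Ico_succ_bot (by omega)]
    congr 1
    · simp
    · refine Finset.sum_congr (by ext; simp) fun j _ => ?_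
      rw [smul_smul, one_div, mul_comm]
  simp only [neuralOp, ht, smul_sub, smul_add, Finset.sum_sub_distrib, Finset.sum_add_distrib,
    ← Finset.sum_smul]
  rw [smul_smul, inv_mul_cancel₀ hV0.ne', one_smul, ← sub_sub, sub_right_comm]
  congr 2
  simp only [Finset.smul_sum, smul_eq_mul, smul_smul]
  rw [Finset.sum_comm]
  refine Finset.sum_congr rfl fun j _ => ?_
  rw [← Finset.sum_smul]
  congr 1
  rw [Finset.mul_sum, Finset.sum_mul]
  exact Finset.sum_congr rfl fun k _ => by ring

end Operator

/-! ### Suprema and moduli of continuity of bounded functions. -/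

section Seminorms

variable {V : Type*} [NormedAddCommGroup V] {g : ℝ → V} {c d δ C : ℝ}

theorem bddAbove_norm_image (h : ∀ y ∈ Set.Icc c d, ‖g y‖ ≤ C) :
    BddAbove ((fun y => ‖g y‖) '' Set.Icc c d) := by
  refine ⟨C, ?_⟩
  rintro _ ⟨y, hy, rfl⟩
  exact h y hy

theorem norm_le_supNormOn (h : ∀ y ∈ Set.Icc c d, ‖g y‖ ≤ C) {y : ℝ} (hy : y ∈ Set.Icc c d) :
    ‖g y‖ ≤ supNormOn g c d :=
  le_csSup (bddAbove_norm_image h) ⟨y, hy, rfl⟩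

theorem supNormOn_nonneg : 0 ≤ supNormOn g c d :=
  Real.sSup_nonneg (by rintro _ ⟨y, _, rfl⟩; exact norm_nonneg _)

theorem supNormOn_le (hcd : c ≤ d) (h : ∀ y ∈ Set.Icc c d, ‖g y‖ ≤ C) : supNormOn g c d ≤ C :=
  csSup_le ((Set.nonempty_Icc.2 hcd).image _) (by rintro _ ⟨y, hy, rfl⟩; exact h y hy)

theorem modCont_nonneg : 0 ≤ modCont g δ c d :=
  Real.sSup_nonneg (by rintro _ ⟨u, _, v, _, _, rfl⟩; exact norm_nonneg _)

theorem norm_sub_le_of_norm_le (h : ∀ y ∈ Set.Icc c d, ‖g y‖ ≤ C) {u v : ℝ}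
    (hu : u ∈ Set.Icc c d) (hv : v ∈ Set.Icc c d) : ‖g u - g v‖ ≤ 2 * C := by
  linarith [norm_sub_le (g u) (g v), h u hu, h v hv]

theorem norm_sub_le_modCont (h : ∀ y ∈ Set.Icc c d, ‖g y‖ ≤ C) {u v : ℝ}
    (hu : u ∈ Set.Icc c d) (hv : v ∈ Set.Icc c d) (huv : |u - v| ≤ δ) :
    ‖g u - g v‖ ≤ modCont g δ c d := by
  refine le_csSup ⟨2 * C, ?_⟩ ⟨u, hu, v, hv, huv, rfl⟩
  rintro _ ⟨u, hu, v, hv, _, rfl⟩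
  exact norm_sub_le_of_norm_le h hu hv

theorem modCont_le (h : ∀ y ∈ Set.Icc c d, ‖g y‖ ≤ C) (hC : 0 ≤ C) : modCont g δ c d ≤ 2 * C := by
  refine Real.sSup_le ?_ (by linarith)
  rintro _ ⟨u, hu, v, hv, _, rfl⟩
  exact norm_sub_le_of_norm_le h hu hv

end Seminorms

/-! ### Error bounds, their limits, and the estimates for the operator. -/

section Caputo

variable {X : Type*} [NormedAddCommGroup X] [NormedSpace ℝ X] {a b α β : ℝ} {f : ℝ → X}
  {m n : ℕ} {x C : ℝ}

theorem fracTerm_nonneg (hx : x ∈ Set.Icc a b) : 0 ≤ fracTerm a b α β m f n x := by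
  have h1 : 0 ≤ (x - a) ^ α := Real.rpow_nonneg (sub_nonneg.2 hx.1) _
  have h2 : 0 ≤ (b - x) ^ α := Real.rpow_nonneg (sub_nonneg.2 hx.2) _
  -- The even exponent makes the sign right for every `n`, including those with `n^{1-β} < 2`.
  have h3 := (even_two_mul m).pow_nonneg ((n : ℝ) ^ (1 - β) - 2)
  have h4 := modCont_nonneg (g := caputoRight a b α f x) (δ := 1 / (n : ℝ) ^ β) (c := a) (d := x)
  have h5 := modCont_nonneg (g := caputoLeft a b α f x) (δ := 1 / (n : ℝ) ^ β) (c := x) (d := b)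
  have h6 := supNormOn_nonneg (g := caputoRight a b α f x) (c := a) (d := x)
  have h7 := supNormOn_nonneg (g := caputoLeft a b α f x) (c := x) (d := b)
  rw [fracTerm]
  positivity

theorem pointBound_nonneg (hα : 0 < α) (hx : x ∈ Set.Icc a b) :
    0 ≤ pointBound a b α β m f n x := by
  have h0 : 0 ≤ b - a := by linarith [hx.1, hx.2]
  have h1 := fracTerm_nonneg (α := α) (β := β) (m := m) (f := f) (n := n) hx
  have h2 := Real.Gamma_pos_of_pos (show 0 < α + 1 by linarith)
  have h3 := (even_two_mul m).pow_nonneg ((n : ℝ) ^ (1 - β) - 2)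
  rw [pointBound]
  positivity

theorem fracTerm_le (hα : 0 < α) (hC : ∀ x ∈ Set.Icc a b,
      (∀ y ∈ Set.Icc a x, ‖caputoRight a b α f x y‖ ≤ C) ∧
      (∀ y ∈ Set.Icc x b, ‖caputoLeft a b α f x y‖ ≤ C)) (hx : x ∈ Set.Icc a b) :
    fracTerm a b α β m f n x ≤
      ((⨆ x : Set.Icc a b, modCont (caputoRight a b α f x) (1 / (n : ℝ) ^ β) a x)
          + (⨆ x : Set.Icc a b, modCont (caputoLeft a b α f x) (1 / (n : ℝ) ^ β) x b))
          / (n : ℝ) ^ (α * β)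
        + (b - a) ^ α / (4 * (m : ℝ) * ((n : ℝ) ^ (1 - β) - 2) ^ (2 * m))
          * ((⨆ x : Set.Icc a b, supNormOn (caputoRight a b α f x) a x)
            + (⨆ x : Set.Icc a b, supNormOn (caputoLeft a b α f x) x b)) := by
  have hC0 : 0 ≤ C := (norm_nonneg _).trans ((hC x hx).1 x ⟨hx.1, le_rfl⟩)
  have h1 : modCont (caputoRight a b α f x) (1 / (n : ℝ) ^ β) a x
      ≤ ⨆ x : Set.Icc a b, modCont (caputoRight a b α f x) (1 / (n : ℝ) ^ β) a x := by
    refine le_ciSup (f := fun x : Set.Icc a b =>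
      modCont (caputoRight a b α f x) (1 / (n : ℝ) ^ β) a x) ⟨2 * C, ?_⟩ ⟨x, hx⟩
    rintro _ ⟨z, rfl⟩
    exact modCont_le (hC z z.2).1 hC0
  have h2 : modCont (caputoLeft a b α f x) (1 / (n : ℝ) ^ β) x b
      ≤ ⨆ x : Set.Icc a b, modCont (caputoLeft a b α f x) (1 / (n : ℝ) ^ β) x b := by
    refine le_ciSup (f := fun x : Set.Icc a b =>
      modCont (caputoLeft a b α f x) (1 / (n : ℝ) ^ β) x b) ⟨2 * C, ?_⟩ ⟨x, hx⟩
    rintro _ ⟨z, rfl⟩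
    exact modCont_le (hC z z.2).2 hC0
  have h3 : supNormOn (caputoRight a b α f x) a x
      ≤ ⨆ x : Set.Icc a b, supNormOn (caputoRight a b α f x) a x := by
    refine le_ciSup (f := fun x : Set.Icc a b =>
      supNormOn (caputoRight a b α f x) a x) ⟨C, ?_⟩ ⟨x, hx⟩
    rintro _ ⟨z, rfl⟩
    exact supNormOn_le z.2.1 (hC z z.2).1
  have h4 : supNormOn (caputoLeft a b α f x) x b
      ≤ ⨆ x : Set.Icc a b, supNormOn (caputoLeft a b α f x) x b := by
    refine le_ciSup (f := fun x : Set.Icc a b =>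
      supNormOn (caputoLeft a b α f x) x b) ⟨C, ?_⟩ ⟨x, hx⟩
    rintro _ ⟨z, rfl⟩
    exact supNormOn_le z.2.2 (hC z z.2).2
  have h5 : (x - a) ^ α ≤ (b - a) ^ α :=
    Real.rpow_le_rpow (sub_nonneg.2 hx.1) (by linarith [hx.2]) hα.le
  have h6 : (b - x) ^ α ≤ (b - a) ^ α :=
    Real.rpow_le_rpow (sub_nonneg.2 hx.2) (by linarith [hx.1]) hα.le
  have h7 := (even_two_mul m).pow_nonneg ((n : ℝ) ^ (1 - β) - 2)
  have h8 : 0 ≤ (x - a) ^ α := Real.rpow_nonneg (sub_nonneg.2 hx.1) _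
  have h9 : 0 ≤ (b - x) ^ α := Real.rpow_nonneg (sub_nonneg.2 hx.2) _
  have h10 := supNormOn_nonneg (g := caputoRight a b α f x) (c := a) (d := x)
  have h11 := supNormOn_nonneg (g := caputoLeft a b α f x) (c := x) (d := b)
  rw [fracTerm]
  refine add_le_add (by gcongr) ?_
  have h12 : 0 ≤ 1 / (4 * (m : ℝ) * ((n : ℝ) ^ (1 - β) - 2) ^ (2 * m)) := by positivity
  have h13 : ∀ r s t : ℝ, r / s * t = 1 / s * (r * t) := fun r s t => by ring
  rw [h13 ((b - a) ^ α)]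
  refine mul_le_mul_of_nonneg_left ?_ h12
  rw [mul_add, mul_comm ((b - a) ^ α), mul_comm ((b - a) ^ α)]
  exact add_le_add (mul_le_mul h3 h5 h8 (h10.trans h3)) (mul_le_mul h4 h6 h9 (h11.trans h4))

theorem pointBound_le_unifBound (hab : a < b) (hα : 0 < α)
    (hf : ContDiffOn ℝ (⌈α⌉₊ : ℕ) f (Set.Icc a b)) (hC : ∀ x ∈ Set.Icc a b,
      (∀ y ∈ Set.Icc a x, ‖caputoRight a b α f x y‖ ≤ C) ∧
      (∀ y ∈ Set.Icc x b, ‖caputoLeft a b α f x y‖ ≤ C)) (hx : x ∈ Set.Icc a b) :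
    pointBound a b α β m f n x ≤ unifBound a b α β m f n := by
  have h0 : 0 ≤ b - a := by linarith
  have h2 := Real.Gamma_pos_of_pos (show 0 < α + 1 by linarith)
  have h3 := (even_two_mul m).pow_nonneg ((n : ℝ) ^ (1 - β) - 2)
  have h4 := one_le_two_mul_rpow m
  rw [pointBound, unifBound]
  refine mul_le_mul_of_nonneg_left (add_le_add (Finset.sum_le_sum fun j hj => ?_)
    (mul_le_mul_of_nonneg_left (fracTerm_le hα hC hx) (by positivity))) (by linarith)
  rw [Finset.mem_Icc] at hj
  have hc := hf.continuousOn_iteratedDerivWithin (m := j) (by norm_cast; omega)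
    (uniqueDiffOn_Icc hab)
  obtain ⟨M, hM⟩ := (isCompact_Icc.bddAbove_image hc.norm : BddAbove _)
  have := norm_le_supNormOn (C := M) (g := iteratedDerivWithin j f (Set.Icc a b))
    (fun y hy => hM ⟨y, hy, rfl⟩) hx
  gcongr

theorem tendsto_tail (hβ1 : β < 1) (hm : 1 ≤ m) (r : ℝ) :
    Tendsto (fun n : ℕ => r / (4 * (m : ℝ) * ((n : ℝ) ^ (1 - β) - 2) ^ (2 * m))) atTop (𝓝 0) := by
  have hm1 : (1 : ℝ) ≤ m := by exact_mod_cast hm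
  have h1 : Tendsto (fun n : ℕ => (n : ℝ) ^ (1 - β) - 2) atTop atTop :=
    tendsto_atTop_add_const_right _ (-2)
      ((tendsto_rpow_atTop (sub_pos.2 hβ1)).comp tendsto_natCast_atTop_atTop)
  exact tendsto_const_nhds.div_atTop
    (((tendsto_pow_atTop (by omega)).comp h1).const_mul_atTop (by positivity))

/-- The moduli of continuity are merely bounded by `2 * C`; the decay comes from dividing by
`n^{αβ}`, so no equicontinuity in the base point is involved. -/
theorem tendsto_unifBound (hab : a < b) (hα : 0 < α) (hβ0 : 0 < β) (hβ1 : β < 1) (hm : 1 ≤ m)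
    (hC : ∀ x ∈ Set.Icc a b,
      (∀ y ∈ Set.Icc a x, ‖caputoRight a b α f x y‖ ≤ C) ∧
      (∀ y ∈ Set.Icc x b, ‖caputoLeft a b α f x y‖ ≤ C)) :
    Tendsto (fun n : ℕ => unifBound a b α β m f n) atTop (𝓝 0) := by
  have hC0 : 0 ≤ C := (norm_nonneg _).trans ((hC a ⟨le_rfl, hab.le⟩).1 a ⟨le_rfl, le_rfl⟩)
  have hp : ∀ r : ℝ, 0 < r → Tendsto (fun n : ℕ => 1 / (n : ℝ) ^ r) atTop (𝓝 0) := fun r hr =>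
    tendsto_const_nhds.div_atTop ((tendsto_rpow_atTop hr).comp tendsto_natCast_atTop_atTop)
  have h1 : Tendsto (fun n : ℕ => ∑ j ∈ Finset.Icc 1 (⌈α⌉₊ - 1),
      supNormOn (iteratedDerivWithin j f (Set.Icc a b)) a b / (j ! : ℝ)
        * (1 / (n : ℝ) ^ (β * (j : ℝ))
          + (b - a) ^ j / (4 * (m : ℝ) * ((n : ℝ) ^ (1 - β) - 2) ^ (2 * m)))) atTop (𝓝 0) := by
    refine (tendsto_finsetSum (a := fun _ => (0 : ℝ)) _ fun j hj => ?_).trans_eq (by simp)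
    have hj0 : (0 : ℝ) < j := by exact_mod_cast (Finset.mem_Icc.1 hj).1
    simpa using ((hp (β * j) (by positivity)).add (tendsto_tail hβ1 hm ((b - a) ^ j))).const_mul
      (supNormOn (iteratedDerivWithin j f (Set.Icc a b)) a b / (j ! : ℝ))
  have h2 : Tendsto (fun n : ℕ =>
      ((⨆ x : Set.Icc a b, modCont (caputoRight a b α f x) (1 / (n : ℝ) ^ β) a x)
        + (⨆ x : Set.Icc a b, modCont (caputoLeft a b α f x) (1 / (n : ℝ) ^ β) x b))
        / (n : ℝ) ^ (α * β)) atTop (𝓝 0) := by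
    have h3 := (hp (α * β) (by positivity)).const_mul (2 * C + 2 * C)
    rw [mul_zero] at h3
    refine squeeze_zero (fun n => ?_) (fun n => ?_) h3
    · exact div_nonneg (add_nonneg (Real.iSup_nonneg fun _ => modCont_nonneg)
        (Real.iSup_nonneg fun _ => modCont_nonneg)) (by positivity)
    · rw [div_eq_mul_one_div]
      refine mul_le_mul_of_nonneg_right (add_le_add ?_ ?_) (by positivity)
      · exact Real.iSup_le (fun z => modCont_le (hC z z.2).1 hC0) (by linarith)
      · exact Real.iSup_le (fun z => modCont_le (hC z z.2).2 hC0) (by linarith)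
  have h4 := (tendsto_tail hβ1 hm ((b - a) ^ α)).mul_const
    ((⨆ x : Set.Icc a b, supNormOn (caputoRight a b α f x) a x)
      + (⨆ x : Set.Icc a b, supNormOn (caputoLeft a b α f x) x b))
  rw [zero_mul] at h4
  have h5 := (h1.add ((h2.add h4).const_mul (1 / Real.Gamma (α + 1)))).const_mul
    (2 * (1 + 4 ^ m : ℝ) ^ (1 / (2 * (m : ℝ))))
  simp only [add_zero, mul_zero] at h5
  exact h5

theorem norm_neuralOp_sub_taylor_le [CompleteSpace X] (hab : a < b) (hα : 0 < α)
    (hαN : α < ⌈α⌉₊) (hf : ContDiffOn ℝ (⌈α⌉₊ : ℕ) f (Set.Icc a b)) (hβ1 : β < 1) (hm : 1 ≤ m)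
    (hC : ∀ x ∈ Set.Icc a b,
      (∀ y ∈ Set.Icc a x, ‖caputoRight a b α f x y‖ ≤ C) ∧
      (∀ y ∈ Set.Icc x b, ‖caputoLeft a b α f x y‖ ≤ C))
    (hn : 2 < (n : ℝ) ^ (1 - β)) (hnab : ⌈(n : ℝ) * a⌉ ≤ ⌊(n : ℝ) * b⌋) (hx : x ∈ Set.Icc a b) :
    ‖neuralOp m a b n f x
        - (∑ j ∈ Finset.Icc 1 (⌈α⌉₊ - 1),
            neuralOp m a b n (fun t : ℝ => (t - x) ^ j) x •
              ((1 / (j ! : ℝ)) • iteratedDerivWithin j f (Set.Icc a b) x))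
        - f x‖
      ≤ 2 * (1 + 4 ^ m : ℝ) ^ (1 / (2 * (m : ℝ))) / Real.Gamma (α + 1)
          * fracTerm a b α β m f n x := by
  have hn0 : 0 < (n : ℝ) := natCast_pos_of_two_lt_rpow (sub_pos.2 hβ1) hn
  obtain ⟨N, hN⟩ : ∃ N, ⌈α⌉₊ = N + 1 := Nat.exists_eq_succ_of_ne_zero (Nat.ceil_pos.2 hα).ne'
  have hΓ := Real.Gamma_pos_of_pos (show 0 < α + 1 by linarith)
  set δ := 1 / (n : ℝ) ^ β with hδ
  have hδ0 : 0 ≤ δ := by positivity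
  have hδα : δ ^ α = 1 / (n : ℝ) ^ (α * β) := by
    rw [hδ, Real.div_rpow zero_le_one (by positivity), Real.one_rpow, ← Real.rpow_mul hn0.le,
      mul_comm]
  set ωl := modCont (caputoRight a b α f x) δ a x with hωl
  set ωr := modCont (caputoLeft a b α f x) δ x b with hωr
  have hωl0 : 0 ≤ ωl := modCont_nonneg
  have hωr0 : 0 ≤ ωr := modCont_nonneg
  set Sl := supNormOn (caputoRight a b α f x) a x with hSl
  set Sr := supNormOn (caputoLeft a b α f x) x b with hSr
  have hSl0 : 0 ≤ Sl := supNormOn_nonneg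
  have hSr0 : 0 ≤ Sr := supNormOn_nonneg
  have h8 : 0 ≤ (x - a) ^ α := Real.rpow_nonneg (sub_nonneg.2 hx.1) _
  have h9 : 0 ≤ (b - x) ^ α := Real.rpow_nonneg (sub_nonneg.2 hx.2) _
  have hN' : ⌈α⌉₊ - 1 = N := by omega
  rw [hN', ← neuralOp_sub_taylorWithinEval hm hn0 hnab hx]
  -- The sum `ωl + ωr` covers a near node on either side of `x`.
  refine (norm_neuralOp_le hm hβ1 hn hnab hx (A := (ωl + ωr) * δ ^ α / Real.Gamma (α + 1))
    (B := Sl * (x - a) ^ α / Real.Gamma (α + 1)) (C := Sr * (b - x) ^ α / Real.Gamma (α + 1))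
    (by positivity) (by positivity) (by positivity) ?_ ?_ ?_).trans_eq ?_
  · intro y hy hyx
    have hyx' := abs_le.1 hyx
    rcases le_total x y with hxy | hxy
    · refine (norm_sub_taylorWithinEval_le_of_caputoLeft hab hα hαN hN hf hx ⟨hxy, hy.2⟩
        (K := ωr) fun t ht => ?_).trans ?_
      -- Vanishing at the base point turns the value at `t` into an increment, which the modulus of
      -- continuity controls.
      · rw [← sub_zero (caputoLeft a b α f x t), ← caputoLeft_self (x := x)]
        refine norm_sub_le_modCont (hC x hx).2 ⟨ht.1, ht.2.trans hy.2⟩ ⟨le_rfl, hx.2⟩ ?_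
        rw [abs_le]
        constructor <;> linarith [ht.1, ht.2]
      · have := Real.rpow_le_rpow (sub_nonneg.2 hxy) hyx'.2 hα.le
        have h0 : 0 ≤ (y - x) ^ α := Real.rpow_nonneg (sub_nonneg.2 hxy) _
        gcongr
        linarith
    · refine (norm_sub_taylorWithinEval_le_of_caputoRight hab hα hαN hN hf hx ⟨hy.1, hxy⟩
        (K := ωl) fun t ht => ?_).trans ?_
      · rw [← sub_zero (caputoRight a b α f x t), ← caputoRight_self (x := x)]
        refine norm_sub_le_modCont (hC x hx).1 ⟨hy.1.trans ht.1, ht.2⟩ ⟨hx.1, le_rfl⟩ ?_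
        rw [abs_le]
        constructor <;> linarith [ht.1, ht.2]
      · have := Real.rpow_le_rpow (sub_nonneg.2 hxy) (show x - y ≤ δ by linarith) hα.le
        have h0 : 0 ≤ (x - y) ^ α := Real.rpow_nonneg (sub_nonneg.2 hxy) _
        gcongr
        linarith
  · intro y hy
    refine (norm_sub_taylorWithinEval_le_of_caputoRight hab hα hαN hN hf hx hy (K := Sl)
      fun t ht => norm_le_supNormOn (hC x hx).1 ⟨hy.1.trans ht.1, ht.2⟩).trans ?_
    have := Real.rpow_le_rpow (sub_nonneg.2 hy.2) (sub_le_sub_left hy.1 x) hα.le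
    gcongr
  · intro y hy
    refine (norm_sub_taylorWithinEval_le_of_caputoLeft hab hα hαN hN hf hx hy (K := Sr)
      fun t ht => norm_le_supNormOn (hC x hx).2 ⟨ht.1, ht.2.trans hy.2⟩).trans ?_
    have := Real.rpow_le_rpow (sub_nonneg.2 hy.1) (sub_le_sub_right hy.2 x) hα.le
    gcongr
  · rw [fracTerm, hδα]
    ring

theorem norm_neuralOp_sub_pow_le (hβ1 : β < 1) (hm : 1 ≤ m)
    (hn : 2 < (n : ℝ) ^ (1 - β)) (hnab : ⌈(n : ℝ) * a⌉ ≤ ⌊(n : ℝ) * b⌋) (hx : x ∈ Set.Icc a b)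
    {j : ℕ} (hj : 1 ≤ j) :
    ‖neuralOp m a b n (fun t : ℝ => (t - x) ^ j) x‖
      ≤ 2 * (1 + 4 ^ m : ℝ) ^ (1 / (2 * (m : ℝ))) * (1 / (n : ℝ) ^ (β * (j : ℝ))
          + (b - a) ^ j / (4 * (m : ℝ) * ((n : ℝ) ^ (1 - β) - 2) ^ (2 * m))) := by
  have hn0 : 0 < (n : ℝ) := natCast_pos_of_two_lt_rpow (sub_pos.2 hβ1) hn
  have hxa := sub_nonneg.2 hx.1
  have hxb := sub_nonneg.2 hx.2
  have h3 := (even_two_mul m).pow_nonneg ((n : ℝ) ^ (1 - β) - 2)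
  have h4 := one_le_two_mul_rpow m
  refine (norm_neuralOp_le hm hβ1 hn hnab hx (A := 1 / (n : ℝ) ^ (β * (j : ℝ)))
    (B := (x - a) ^ j) (C := (b - x) ^ j) (by positivity) (by positivity) (by positivity)
    ?_ ?_ ?_).trans ?_
  · intro y _ hyx
    rw [norm_pow, Real.norm_eq_abs, Real.rpow_mul hn0.le, Real.rpow_natCast, ← one_div_pow]
    exact pow_le_pow_left₀ (abs_nonneg _) hyx j
  · intro y hy
    rw [norm_pow, Real.norm_eq_abs, abs_sub_comm, abs_of_nonneg (sub_nonneg.2 hy.2)]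
    exact pow_le_pow_left₀ (sub_nonneg.2 hy.2) (by linarith [hy.1]) j
  · intro y hy
    rw [norm_pow, Real.norm_eq_abs, abs_of_nonneg (sub_nonneg.2 hy.1)]
    exact pow_le_pow_left₀ (sub_nonneg.2 hy.1) (by linarith [hy.2]) j
  -- Superadditivity of `t ↦ t^j` for `j ≥ 1` merges the two tails without a factor `2`.
  · have h5 : (x - a) ^ j + (b - x) ^ j ≤ (b - a) ^ j := by
      have := pow_add_pow_le hxa hxb (n := j) (by omega)
      rwa [show x - a + (b - x) = b - a by ring] at this
    gcongr

theorem norm_neuralOp_sub_le_pointBound [CompleteSpace X] (hab : a < b) (hα : 0 < α)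
    (hαN : α < ⌈α⌉₊) (hf : ContDiffOn ℝ (⌈α⌉₊ : ℕ) f (Set.Icc a b)) (hβ1 : β < 1)
    (hm : 1 ≤ m) (hC : ∀ x ∈ Set.Icc a b,
      (∀ y ∈ Set.Icc a x, ‖caputoRight a b α f x y‖ ≤ C) ∧
      (∀ y ∈ Set.Icc x b, ‖caputoLeft a b α f x y‖ ≤ C))
    (hn : 2 < (n : ℝ) ^ (1 - β)) (hnab : ⌈(n : ℝ) * a⌉ ≤ ⌊(n : ℝ) * b⌋) (hx : x ∈ Set.Icc a b) :
    ‖neuralOp m a b n f x - f x‖ ≤ pointBound a b α β m f n x := by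
  have h1 := norm_neuralOp_sub_taylor_le hab hα hαN hf hβ1 hm hC hn hnab hx
  set S := ∑ j ∈ Finset.Icc 1 (⌈α⌉₊ - 1), neuralOp m a b n (fun t : ℝ => (t - x) ^ j) x •
    ((1 / (j ! : ℝ)) • iteratedDerivWithin j f (Set.Icc a b) x) with hS
  have h2 : ‖S‖ ≤ 2 * (1 + 4 ^ m : ℝ) ^ (1 / (2 * (m : ℝ))) *
      ∑ j ∈ Finset.Icc 1 (⌈α⌉₊ - 1), ‖iteratedDerivWithin j f (Set.Icc a b) x‖ / (j ! : ℝ)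
        * (1 / (n : ℝ) ^ (β * (j : ℝ))
          + (b - a) ^ j / (4 * (m : ℝ) * ((n : ℝ) ^ (1 - β) - 2) ^ (2 * m))) := by
    rw [Finset.mul_sum]
    refine norm_sum_le_of_le _ fun j hj => ?_
    rw [norm_smul, norm_smul, Real.norm_of_nonneg (show 0 ≤ 1 / (j ! : ℝ) by positivity)]
    refine (mul_le_mul_of_nonneg_right (norm_neuralOp_sub_pow_le hβ1 hm hn hnab hx
      (Finset.mem_Icc.1 hj).1) (by positivity)).trans_eq ?_
    ring
  have h3 : neuralOp m a b n f x - f x = (neuralOp m a b n f x - S - f x) + S := by abel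
  rw [h3, pointBound, mul_add]
  refine (norm_add_le _ _).trans ((add_le_add h1 h2).trans_eq ?_)
  ring

end Caputo

theorem theorem30 {X : Type*} [NormedAddCommGroup X] [NormedSpace ℝ X] [CompleteSpace X]
    (a b : ℝ) (hab : a < b) (α : ℝ) (hα : 0 < α) (hαN : ∀ k : ℕ, α ≠ (k : ℝ))
    (f : ℝ → X) (hf : ContDiffOn ℝ (⌈α⌉₊ : ℕ) f (Set.Icc a b))
    (β : ℝ) (hβ0 : 0 < β) (hβ1 : β < 1) (m : ℕ) (hm : 1 ≤ m) :
    -- the fractional derivatives are bounded uniformly in the base point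
    (∃ C : ℝ, ∀ x ∈ Set.Icc a b,
      (∀ y ∈ Set.Icc a x, ‖caputoRight a b α f x y‖ ≤ C) ∧
      (∀ y ∈ Set.Icc x b, ‖caputoLeft a b α f x y‖ ≤ C)) ∧
    -- the error estimates
    (∀ n : ℕ, 2 < (n : ℝ) ^ (1 - β) → ⌈(n : ℝ) * a⌉ ≤ ⌊(n : ℝ) * b⌋ →
      (∀ x ∈ Set.Icc a b,
        ‖neuralOp m a b n f x
            - (∑ j ∈ Finset.Icc 1 (⌈α⌉₊ - 1),
                neuralOp m a b n (fun t : ℝ => (t - x) ^ j) x •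
                  ((1 / (j ! : ℝ)) • iteratedDerivWithin j f (Set.Icc a b) x))
            - f x‖
          ≤ 2 * (1 + 4 ^ m : ℝ) ^ (1 / (2 * (m : ℝ))) / Real.Gamma (α + 1)
              * fracTerm a b α β m f n x) ∧
      (∀ x ∈ Set.Icc a b,
        (∀ j ∈ Finset.Icc 1 (⌈α⌉₊ - 1), iteratedDerivWithin j f (Set.Icc a b) x = 0) →
        ‖neuralOp m a b n f x - f x‖
          ≤ 2 * (1 + 4 ^ m : ℝ) ^ (1 / (2 * (m : ℝ))) / Real.Gamma (α + 1)
              * fracTerm a b α β m f n x) ∧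
      (∀ x ∈ Set.Icc a b, ‖neuralOp m a b n f x - f x‖ ≤ pointBound a b α β m f n x) ∧
      BddAbove ((fun x => ‖neuralOp m a b n f x - f x‖) '' Set.Icc a b) ∧
      supNormOn (fun x => neuralOp m a b n f x - f x) a b ≤ unifBound a b α β m f n) ∧
    -- pointwise and uniform convergence, with the above rates
    (∀ x ∈ Set.Icc a b,
      Tendsto (fun n : ℕ => pointBound a b α β m f n x) atTop (𝓝 0) ∧
      Tendsto (fun n : ℕ => neuralOp m a b n f x) atTop (𝓝 (f x))) ∧
    Tendsto (fun n : ℕ => unifBound a b α β m f n) atTop (𝓝 0) ∧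
    TendstoUniformlyOn (fun (n : ℕ) (x : ℝ) => neuralOp m a b n f x) f atTop (Set.Icc a b) := by
  
  have hαN' : α < ⌈α⌉₊ := lt_of_le_of_ne (Nat.le_ceil α) (hαN _)
  obtain ⟨C, hC⟩ := exists_caputo_bound hab hαN' hf
  have hpt : ∀ n : ℕ, 2 < (n : ℝ) ^ (1 - β) → ⌈(n : ℝ) * a⌉ ≤ ⌊(n : ℝ) * b⌋ →
      ∀ x ∈ Set.Icc a b, ‖neuralOp m a b n f x - f x‖ ≤ pointBound a b α β m f n x :=
    fun n hn hnab x hx =>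
      norm_neuralOp_sub_le_pointBound hab hα hαN' hf hβ1 hm hC hn hnab hx
  have hun : ∀ n : ℕ, ∀ x ∈ Set.Icc a b, pointBound a b α β m f n x ≤ unifBound a b α β m f n :=
    fun n x hx => pointBound_le_unifBound hab hα hf hC hx
  have hlim : Tendsto (fun n : ℕ => unifBound a b α β m f n) atTop (𝓝 0) :=
    tendsto_unifBound hab hα hβ0 hβ1 hm hC
  -- Once `n (b - a) ≥ 1`, one has `⌈na⌉ < na + 1 ≤ nb`, so the node range is nonempty.
  have hev : ∀ᶠ n : ℕ in atTop, 2 < (n : ℝ) ^ (1 - β) ∧ ⌈(n : ℝ) * a⌉ ≤ ⌊(n : ℝ) * b⌋ := by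
    have h1 := ((tendsto_rpow_atTop (sub_pos.2 hβ1)).comp
      tendsto_natCast_atTop_atTop).eventually_gt_atTop (2 : ℝ)
    have h2 := (tendsto_natCast_atTop_atTop (R := ℝ)).eventually_ge_atTop (1 / (b - a))
    filter_upwards [h1, h2] with n h1 h2
    refine ⟨h1, Int.le_floor.2 ?_⟩
    rw [div_le_iff₀ (sub_pos.2 hab)] at h2
    linarith [Int.ceil_lt_add_one ((n : ℝ) * a)]
  have hunif : TendstoUniformlyOn (fun (n : ℕ) (x : ℝ) => neuralOp m a b n f x) f atTop
      (Set.Icc a b) := by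
    rw [Metric.tendstoUniformlyOn_iff]
    intro ε hε
    filter_upwards [hev, hlim.eventually_lt_const hε] with n hn hlt x hx
    rw [dist_comm, dist_eq_norm]
    exact ((hpt n hn.1 hn.2 x hx).trans (hun n x hx)).trans_lt hlt
  refine ⟨⟨C, hC⟩, fun n hn hnab => ⟨fun x hx => ?_, fun x hx h0 => ?_, hpt n hn hnab, ?_, ?_⟩,
    fun x hx => ⟨?_, hunif.tendsto_at hx⟩, hlim, hunif⟩
  · exact norm_neuralOp_sub_taylor_le hab hα hαN' hf hβ1 hm hC hn hnab hx
  · have h1 := norm_neuralOp_sub_taylor_le hab hα hαN' hf hβ1 hm hC hn hnab hx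
    rwa [Finset.sum_eq_zero (fun j hj => by rw [h0 j hj, smul_zero, smul_zero]), sub_zero] at h1
  · exact bddAbove_norm_image fun x hx => (hpt n hn hnab x hx).trans (hun n x hx)
  · exact supNormOn_le hab.le fun x hx => (hpt n hn hnab x hx).trans (hun n x hx)
  · exact squeeze_zero (fun n => pointBound_nonneg hα hx) (fun n => hun n x hx) hlim
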